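/- Let $k$ be an algebraically closed field of characteristic $0$, let $n\ge 0$ be an integer, and let $\mathfrak{G}=\mathfrak{sl}_2(k)\otimes k[t]$ be the Lie algebra with bracket $[x(a),y(b)]=[x,y](ab)$, where $x(a)=x\otimes a$; let $\{e,f,h\}$ be the standard basis of $\mathfrak{sl}_2(k)$. For a vector space $M$ with a linear map $\rho:k[t]\to\mathrm{End}(M)$ such that the operators $\rho(a)$ commute with each other, let $V(M)=U(\mathfrak{G})\otimes_{U(h\otimes k[t]\,\oplus\, e\otimes k[t])}M$, where $h(a)$ acts on $M$ by $\rho(a)$ and $e(a)$ acts by $0$. For an integer $\ell$ let $V(M)_\ell=\{v\in V(M): h(1)v=\ell v\}$. The Weyl module is $$\Delta_n(M)=V(M)\Big/\,U(\mathfrak{G})\sum_{\ell<-n}V(M)_\ell .$$ Let $\mathcal{U}_n(k[t])$ be the quotient of the tensor algebra $T(k[t])$ by the two-sided ideal generated by the following elements, for all $a,b,c\in k[t]$: the difference between the element $1\in k[t]$ (in tensor degree one) and $n$ times the unit of $T(k[t])$; $a\otimes a^2-a^2\otimes a$; $[[a,b],c]-4\,\partial_{a,b}c$, where the outer brackets are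 commutators in $T(k[t])$ and $\partial_{a,b}c=a(bc)-b(ac)$ (which is $0$ here); and $\sum_{\sigma\vdash n+1}\mathrm{sgn}(\sigma)\,|C_\sigma|\,a^{\sigma_1}\otimes\cdots\otimes a^{\sigma_m}$, where $C_\sigma$ is the conjugacy class in $S_{n+1}$ of the permutations of cycle type $\sigma=(\sigma_1,\dots,\sigma_m)$ and $\mathrm{sgn}(\sigma)$ is their sign. Let $F=k[x_1,\dots,x_n]^{S_n}$, with $\rho:k[t]\to\mathrm{End}(F)$ the linear map for which $\rho(t^\ell)$ is multiplication by the power sum $N_\ell=x_1^\ell+\cdots+x_n^\ell$ ($\ell\ge0$). Let $L$ be the two-dimensional simple $\mathfrak{sl}_2(k)$-module, and let $L[t]=L\otimes k[t]$ be the $\mathfrak{G}$-module with $(x\otimes p)(v\otimes q)=xv\otimes pq$. Let $S^n(L[t])\subset L[t]^{\otimes n}$ be the $\mathfrak{G}$-submodule of symmetric tensors, that is, of the tensors fixed by all permutations of the $n$ factors, for the diagonal action of $\mathfrak{G}$. Then $\rho$ extends to a $\mathcal{U}_n(k[t])$-module structure on $F$, which is free of rank $1$, and the Weyl module $\Delta_n(F)$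 is isomorphic to $S^n(L[t])$ as a $\mathfrak{G}$-module. -/

import Mathlib

open scoped TensorProduct

noncomputable section

namespace JordanWeyl

/-! ### The universal `J`-space envelope of level `n`

In this section `A` is a commutative associative unital algebra, regarded as a Jordan algebra. -/

section Envelope

variable (k : Type*) [Field k] (A : Type*) [CommRing A] [Algebra k A]

/-- The signature of the permutations of cycle type `σ`. -/
def sgn {N : ℕ} (σ : N.Partition) : ℤ := (-1) ^ (N + Multiset.card σ.parts)

/-- The number of permutations of `N` letters of cycle type `σ` (fixed points counted as parts). -/
def classCard {N : ℕ} (σ : N.Partition) : ℕ :=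
  Nat.card {g : Equiv.Perm (Fin N) // g.partition.parts = σ.parts}

variable {A}

/-- The inner derivation `∂_{a,b} = [L_a, L_b]` applied to `c`
(it vanishes, since `A` is associative and commutative). -/
def innerDer (a b c : A) : A := a * (b * c) - b * (a * c)

/-- The tensor `a^{σ₁} ⊗ ⋯ ⊗ a^{σₘ}`, with `σ₁ ≥ ⋯ ≥ σₘ` the parts of `σ`. -/
def partTensor {N : ℕ} (σ : N.Partition) (a : A) : TensorAlgebra k A :=
  ((σ.parts.sort (· ≥ ·)).map fun i => TensorAlgebra.ι k (a ^ i)).prod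

open TensorAlgebra in
/-- The defining relations of the universal `J`-space envelope of level `n`. -/
inductive EnvRel (n : ℕ) : TensorAlgebra k A → TensorAlgebra k A → Prop
  | level : EnvRel n (ι k 1) (n : TensorAlgebra k A)
  | jordan (a : A) : EnvRel n (ι k a * ι k (a ^ 2)) (ι k (a ^ 2) * ι k a)
  | triple (a b c : A) :
      EnvRel n ((ι k a * ι k b - ι k b * ι k a) * ι k c - ι k c * (ι k a * ι k b - ι k b * ι k a))
        ((4 : k) • ι k (innerDer a b c))
  | dominant (a : A) :
      EnvRel n (∑ σ : (n + 1).Partition, (sgn σ * classCard σ) • partTensor k σ a) 0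

variable (A)

/-- The universal `J`-space envelope `U_n(A)` of level `n`. -/
abbrev Envelope (n : ℕ) : Type _ := RingQuot (EnvRel k (A := A) n)

/-- The canonical map `A → U_n(A)`. -/
def Envelope.of (n : ℕ) : A →ₗ[k] Envelope k A n :=
  (RingQuot.mkAlgHom k (EnvRel k n)).toLinearMap ∘ₗ TensorAlgebra.ι k

variable {k A} {M : Type*} [AddCommGroup M] [Module k M]

/-- The action `ρ : A → End M` extends to a left `U_n(A)`-module structure on `M`, and this module
is free of rank `r`. -/
def IsFreeOfRank (n r : ℕ) (ρ : A →ₗ[k] Module.End k M) : Prop :=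
  ∃ R : Envelope k A n →ₐ[k] Module.End k M, (∀ a, R (Envelope.of k A n a) = ρ a) ∧
    ∃ φ : (Fin r → Envelope k A n) ≃ₗ[k] M, ∀ u w, φ (u • w) = R u (φ w)

end Envelope

/-! ### The Lie algebra `sl₂ ⊗ A` and its Weyl modules -/

section Weyl

variable (k : Type*) [Field k] (A : Type*) [CommRing A] [Algebra k A]

/-- The Lie algebra `sl₂(A) = sl₂(k) ⊗ A` over `k`, with `[x(a), y(b)] = [x,y](ab)`. -/
abbrev Current : Type _ := A ⊗[k] LieAlgebra.SpecialLinear.sl (Fin 2) k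

variable {A}

/-- `e(a)`, where `e = !![0, 1; 0, 0]`. -/
def eElt (a : A) : Current k A :=
  a ⊗ₜ[k] LieAlgebra.SpecialLinear.single 0 1 (by decide) (1 : k)

/-- `h(a)`, where `h = !![1, 0; 0, -1]`. -/
def hElt (a : A) : Current k A :=
  a ⊗ₜ[k] LieAlgebra.SpecialLinear.singleSubSingle 0 1 (1 : k)

variable {k} {M : Type*} [AddCommGroup M] [Module k M]

attribute [local instance 100] LieRing.ofAssociativeRing

open UniversalEnvelopingAlgebra in
/-- The relations `u e(a) ⊗ m = 0` and `u h(a) ⊗ m = u ⊗ ρ(a) m` in `U(sl₂(A)) ⊗ M`. -/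
def vermaRel (ρ : A →ₗ[k] Module.End k M) :
    Submodule (UniversalEnvelopingAlgebra k (Current k A))
      (UniversalEnvelopingAlgebra k (Current k A) ⊗[k] M) :=
  Submodule.span _
    ({z | ∃ u a m, z = (u * ι k (eElt k a)) ⊗ₜ[k] m} ∪
     {z | ∃ u a m, z = (u * ι k (hElt k a)) ⊗ₜ[k] m - u ⊗ₜ[k] ρ a m})

/-- The generalized Verma module `V(M) = U(𝔊) ⊗_{U(𝔊₀ ⊕ 𝔊₁)} M`, where `𝔊 = sl₂(A)`,
`𝔊₀ = h ⊗ A` acts on `M` through `ρ`, and `𝔊₁ = e ⊗ A` acts on `M` by zero. -/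
def Verma (ρ : A →ₗ[k] Module.End k M) : Type _ :=
  (UniversalEnvelopingAlgebra k (Current k A) ⊗[k] M) ⧸ vermaRel ρ

namespace Verma

variable (ρ : A →ₗ[k] Module.End k M)

instance : AddCommGroup (Verma ρ) :=
  inferInstanceAs (AddCommGroup (_ ⧸ vermaRel ρ))

instance : Module (UniversalEnvelopingAlgebra k (Current k A)) (Verma ρ) :=
  inferInstanceAs (Module _ (_ ⧸ vermaRel ρ))

instance : Module k (Verma ρ) :=
  inferInstanceAs (Module k (_ ⧸ vermaRel ρ))

instance : IsScalarTower k (UniversalEnvelopingAlgebra k (Current k A)) (Verma ρ) :=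
  inferInstanceAs (IsScalarTower k _ (_ ⧸ vermaRel ρ))

/-- `𝔊` acts on `V(M)` through `U(𝔊)`. -/
instance : LieRingModule (Current k A) (Verma ρ) where
  bracket x v := UniversalEnvelopingAlgebra.ι k x • v
  add_lie x y v := by
    change UniversalEnvelopingAlgebra.ι k (x + y) • v = _
    rw [map_add, add_smul]
  lie_add x v w := smul_add _ _ _
  leibniz_lie x y v := by
    change _ • (_ • v) = UniversalEnvelopingAlgebra.ι k ⁅x, y⁆ • v + _ • (_ • v)
    rw [LieHom.map_lie, LieRing.of_associative_ring_bracket, sub_smul, mul_smul, mul_smul,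
      sub_add_cancel]

instance : LieModule k (Current k A) (Verma ρ) where
  smul_lie c x v := by
    change UniversalEnvelopingAlgebra.ι k (c • x) • v = c • (_ • v)
    rw [map_smul, smul_assoc]
  lie_smul c x v := by
    change UniversalEnvelopingAlgebra.ι k x • (c • v) =
      c • (UniversalEnvelopingAlgebra.ι k x • v)
    rw [← algebraMap_smul (UniversalEnvelopingAlgebra k (Current k A)) c v,
      ← algebraMap_smul (UniversalEnvelopingAlgebra k (Current k A)) c (_ • v),
      ← mul_smul, ← mul_smul, Algebra.commutes]

end Verma

/-- The weight space `V_ℓ = {v | h(1) v = ℓ v}` of an `sl₂(A)`-module. -/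
def weightSpace (V : Type*) [AddCommGroup V] [Module k V] [LieRingModule (Current k A) V]
    [LieModule k (Current k A) V] (ℓ : ℤ) : Submodule k V :=
  Module.End.eigenspace (LieModule.toEnd k (Current k A) V (hElt k 1)) (ℓ : k)

/-- The submodule of `V(M)` generated by its weight spaces of weight `ℓ < -n`. -/
def lowSubmodule (n : ℕ) (ρ : A →ₗ[k] Module.End k M) :
    LieSubmodule k (Current k A) (Verma ρ) :=
  LieSubmodule.lieSpan k (Current k A)
    ((⨆ ℓ : ℤ, ⨆ _ : ℓ < -(n : ℤ), weightSpace (A := A) (Verma ρ) ℓ : Submodule k (Verma ρ)) :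
      Set (Verma ρ))

/-- The Weyl module `Δ_n(M) = V(M) / U(𝔊) ∑_{ℓ < -n} V(M)_ℓ`. -/
abbrev WeylModule (n : ℕ) (ρ : A →ₗ[k] Module.End k M) : Type _ :=
  Verma ρ ⧸ lowSubmodule n ρ

end Weyl

/-! ### Symmetric tensors -/

section SymmetricTensors

open PiTensorProduct

attribute [local instance 100] LieRing.ofAssociativeRing

variable {k : Type*} [Field k] {G : Type*} [LieRing G] [LieAlgebra k G]
  (V : Type*) [AddCommGroup V] [Module k V] [LieRingModule G V] [LieModule k G V] (n : ℕ)

/-- The endomorphism of `V^{⊗n}` that applies `f` to the `i`-th factor. -/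
def atFactor (i : Fin n) (f : Module.End k V) : Module.End k (⨂[k]^n V) :=
  PiTensorProduct.map (Function.update (fun _ => LinearMap.id) i f)

variable {V n} in
theorem atFactor_tprod (i : Fin n) (f : Module.End k V) (v : Fin n → V) :
    atFactor V n i f (tprod k v) = tprod k (Function.update v i (f (v i))) := by
  rw [atFactor, PiTensorProduct.map_tprod]
  congr 1
  ext j
  by_cases h : j = i
  · subst h; simp
  · simp [h]

variable {V n} in
theorem atFactor_mul_self (i : Fin n) (f g : Module.End k V) :
    atFactor V n i f * atFactor V n i g = atFactor V n i (f * g) := by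
  refine PiTensorProduct.ext (MultilinearMap.ext fun v => ?_)
  simp [atFactor_tprod]

variable {V n} in
theorem atFactor_commute {i j : Fin n} (h : i ≠ j) (f g : Module.End k V) :
    atFactor V n i f * atFactor V n j g = atFactor V n j g * atFactor V n i f := by
  refine PiTensorProduct.ext (MultilinearMap.ext fun v => ?_)
  simp [atFactor_tprod, h, h.symm, Function.update_comm h]

/-- The diagonal action of `G` on `V^{⊗n}`:
`x (v₁ ⊗ ⋯ ⊗ vₙ) = ∑ᵢ v₁ ⊗ ⋯ ⊗ x vᵢ ⊗ ⋯ ⊗ vₙ`. -/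
def tensorAction : G →ₗ⁅k⁆ Module.End k (⨂[k]^n V) where
  toFun x := ∑ i, atFactor V n i (LieModule.toEnd k G V x)
  map_add' x y := by
    simp only [atFactor, map_add, PiTensorProduct.map_update_add, Finset.sum_add_distrib]
  map_smul' c x := by
    simp only [atFactor, map_smul, PiTensorProduct.map_update_smul, Finset.smul_sum,
      RingHom.id_apply]
  map_lie' {x y} := by
    have hsub : ∀ (i : Fin n) (f g : Module.End k V),
        atFactor V n i (f - g) = atFactor V n i f - atFactor V n i g := fun i f g => by
      rw [eq_sub_iff_add_eq]
      simp only [atFactor]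
      rw [← PiTensorProduct.map_update_add, sub_add_cancel]
    rw [LieRing.of_associative_ring_bracket, Finset.sum_mul_sum, Finset.sum_mul_sum,
      Finset.sum_comm (γ := Fin n) (f := fun i j =>
        atFactor V n i (LieModule.toEnd k G V y) * atFactor V n j (LieModule.toEnd k G V x)),
      ← Finset.sum_sub_distrib]
    refine Finset.sum_congr rfl fun i _ => ?_
    rw [← Finset.sum_sub_distrib, Finset.sum_eq_single i, LieHom.map_lie,
      LieRing.of_associative_ring_bracket, hsub, atFactor_mul_self, atFactor_mul_self]
    · intro j _ hj
      rw [atFactor_commute hj.symm, sub_self]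
    · simp

variable {V n} in
theorem tensorAction_tprod (x : G) (v : Fin n → V) :
    tensorAction (k := k) V n x (tprod k v) =
      ∑ i, tprod k (Function.update v i ⁅x, v i⁆) := by
  change (∑ i, atFactor V n i (LieModule.toEnd k G V x)) (tprod k v) = _
  simp [LinearMap.sum_apply, atFactor_tprod]

instance : LieRingModule G (⨂[k]^n V) := LieRingModule.compLieHom _ (tensorAction (k := k) V n)

instance : LieModule k G (⨂[k]^n V) := LieModule.compLieHom _ (tensorAction V n)

/-- `S^n(V) ⊂ V^{⊗n}`, the tensors fixed by all permutations of the factors,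
as a `G`-submodule. -/
def symTensors : LieSubmodule k G (⨂[k]^n V) where
  carrier := {z | ∀ s : Equiv.Perm (Fin n), PiTensorProduct.reindex k (fun _ => V) s z = z}
  zero_mem' s := map_zero _
  add_mem' hx hy s := by rw [map_add, hx s, hy s]
  smul_mem' c x hx s := by rw [map_smul, hx s]
  lie_mem {x z} hz s := by
    change PiTensorProduct.reindex k (fun _ => V) s (tensorAction V n x z) = tensorAction V n x z
    conv_rhs => rw [← hz s]
    have key : (PiTensorProduct.reindex k (fun _ => V) s).toLinearMap ∘ₗ tensorAction (k := k) V n x =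
        tensorAction (k := k) V n x ∘ₗ (PiTensorProduct.reindex k (fun _ => V) s).toLinearMap := by
      refine PiTensorProduct.ext (MultilinearMap.ext fun v => ?_)
      simp only [LinearMap.compMultilinearMap_apply, LinearMap.comp_apply, tensorAction_tprod,
        map_sum, LinearEquiv.coe_coe, PiTensorProduct.reindex_tprod]
      rw [← Equiv.sum_comp s.symm]
      refine Finset.sum_congr rfl fun i _ => ?_
      congr 1
      ext j
      by_cases h : j = i
      · subst h; simp
      · simp [h]
    exact LinearMap.congr_fun key z

end SymmetricTensors

/-! ### The modules `L[t]` and `F` -/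

section Objects

variable (k : Type*) [Field k]

/-- `sl₂(A)` acts `k`-linearly on `A ⊗ L`, by `(x ⊗ a)(v ⊗ b) = xv ⊗ ab`. -/
instance (A : Type*) [CommRing A] [Algebra k A] (L : Type*) [AddCommGroup L] [Module k L]
    [LieRingModule (LieAlgebra.SpecialLinear.sl (Fin 2) k) L]
    [LieModule k (LieAlgebra.SpecialLinear.sl (Fin 2) k) L] :
    LieModule k (Current k A) (A ⊗[k] L) where
  smul_lie c x v := by
    rw [← algebraMap_smul A c x, smul_lie, algebraMap_smul]
  lie_smul c x v := by
    rw [← algebraMap_smul A c v, lie_smul, algebraMap_smul]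

/-- `L[t] = L ⊗ k[t]`, with `L = k²` the natural (two-dimensional simple) `sl₂(k)`-module. -/
abbrev Loops : Type _ := Polynomial k ⊗[k] (Fin 2 → k)

/-- The power sum `N_ℓ = x₁^ℓ + ⋯ + xₙ^ℓ`, as an element of the ring of symmetric polynomials. -/
def newton (n ℓ : ℕ) : MvPolynomial.symmetricSubalgebra (Fin n) k :=
  ⟨MvPolynomial.psum (Fin n) k ℓ, MvPolynomial.psum_isSymmetric (Fin n) k ℓ⟩

/-- The `k[t]`-space `F = k[x₁, …, xₙ]^{Sₙ}`: the linear map `ρ : k[t] → End F` for which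
`ρ(t^ℓ)` is multiplication by `N_ℓ`. -/
def newtonAction (n : ℕ) :
    Polynomial k →ₗ[k] Module.End k (MvPolynomial.symmetricSubalgebra (Fin n) k) :=
  (Polynomial.basisMonomials k).constr k fun ℓ => LinearMap.mulLeft k (newton k n ℓ)

end Objects

end JordanWeyl
end

/-!
Newton's identities attach to every sequence `p` of power sums formal elementary symmetric
functions `newtonE k p`, and the signed sum over the partitions of `N` equals `N! • newtonE k p N`.
Hence the generators of the envelope of `k[t]`, which commute, satisfy
`newtonE k (fun j => a ^ j) (n + 1) = 0` for all `a`. To first order in `s` at `a = t + s t ^ r`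
this is a recurrence that expresses all `t ^ j` through those with `j ≤ n`. Since the first `n`
power sums freely generate `k[x₁, …, xₙ]^{Sₙ}`, the envelope is this ring.

The Weyl module is the sum over `r` of the images of `k[x₁, …, xᵣ]^{Sᵣ} ⊗ F`, where the first
factor is evaluated at the commuting operators `f(a)`. For `r = n + 1` the image is zero by weight.
Applying `e(a)` to this relation `n + 1 - r` times shows that on the annihilator quotient for `r`
the differences `∑ⱼ a(yⱼ) - ∑ᵢ a(xᵢ)` behave like power sums in `n - r` variables. The map from
`k[x₁, …, xᵣ]^{Sᵣ} ⊗ F` therefore factors through the restriction to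
`k[x₁, …, xᵣ]^{Sᵣ} ⊗ k[xᵣ₊₁, …, xₙ]^{Sₙ₋ᵣ}`. In `S^n(L[t])` this restriction, up to the factor
`r!`, is the component at `v₁^{⊗ r} ⊗ v₀^{⊗ (n - r)}`, and these components determine a symmetric
tensor.
-/

noncomputable section

namespace JordanWeyl

/-! ### Newton's identities for formal power sums -/

section NewtonE

open PowerSeries

theorem eq_of_derivative_eq_mul {B : Type*} [CommRing B] [IsAddTorsionFree B] {F G P : B⟦X⟧}
    (hF : d⁄dX B F = P * F) (hG : d⁄dX B G = P * G)
    (h : constantCoeff F = constantCoeff G) : F = G := by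
  ext s
  induction s using Nat.strong_induction_on with
  | _ s ih =>
    cases s with
    | zero => simpa using h
    | succ s =>
      have hcoeff : coeff s (d⁄dX B F) = coeff s (d⁄dX B G) := by
        rw [hF, hG, coeff_mul, coeff_mul]
        refine Finset.sum_congr rfl fun i hi => ?_
        rw [ih i.2 (by have := Finset.HasAntidiagonal.mem_antidiagonal.mp hi; lia)]
      rw [coeff_derivative, coeff_derivative, ← Nat.cast_succ, mul_comm, ← nsmul_eq_mul,
        mul_comm, ← nsmul_eq_mul] at hcoeff
      exact nsmul_right_injective s.succ_ne_zero hcoeff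

variable (k : Type*) [Field k]

/-- The elementary symmetric functions attached to a sequence of power sums by Newton's
identities. -/
def newtonE {B : Type*} [CommRing B] [Algebra k B] (p : ℕ → B) : ℕ → B
  | 0 => 1
  | s + 1 => ((s + 1 : ℕ) : k)⁻¹ •
      ∑ i : Fin (s + 1), (-1) ^ (i : ℕ) * p (i + 1) * newtonE p (s - i)
termination_by s => s
decreasing_by omega

variable {B : Type*} [CommRing B] [Algebra k B] (p q : ℕ → B)

theorem newtonE_zero : newtonE k p 0 = 1 := by rw [newtonE]

theorem newtonE_succ (s : ℕ) : newtonE k p (s + 1) = ((s + 1 : ℕ) : k)⁻¹ •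
    ∑ i ∈ Finset.range (s + 1), (-1) ^ i * p (i + 1) * newtonE k p (s - i) := by
  rw [newtonE, Finset.sum_range fun i => (-1) ^ i * p (i + 1) * newtonE k p (s - i)]

variable {k p q} in
theorem newtonE_congr {s : ℕ} (h : ∀ j, 1 ≤ j → j ≤ s → p j = q j) :
    newtonE k p s = newtonE k q s := by
  induction s using Nat.strong_induction_on with
  | _ s ih =>
    cases s with
    | zero => rw [newtonE_zero, newtonE_zero]
    | succ s =>
      rw [newtonE_succ, newtonE_succ]
      congr 1
      refine Finset.sum_congr rfl fun i hi => ?_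
      have := Finset.mem_range.mp hi
      rw [h (i + 1) (by lia) (by lia), ih (s - i) (by lia) fun j h1 h2 => h j h1 (by lia)]

theorem map_newtonE {C : Type*} [CommRing C] [Algebra k C] (f : B →ₐ[k] C) (s : ℕ) :
    f (newtonE k p s) = newtonE k (fun j => f (p j)) s := by
  induction s using Nat.strong_induction_on with
  | _ s ih =>
    cases s with
    | zero => rw [newtonE_zero, newtonE_zero, map_one]
    | succ s =>
      rw [newtonE_succ, newtonE_succ, map_smul, map_sum]
      congr 1
      refine Finset.sum_congr rfl fun i _ => ?_
      rw [map_mul, map_mul, map_pow, map_neg, map_one, ih _ (by lia)]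

variable {k p} in
theorem newtonE_mem {S : Subalgebra k B} {s : ℕ} (h : ∀ j, 1 ≤ j → j ≤ s → p j ∈ S) :
    newtonE k p s ∈ S := by
  induction s using Nat.strong_induction_on with
  | _ s ih =>
    cases s with
    | zero => rw [newtonE_zero]; exact S.one_mem
    | succ s =>
      rw [newtonE_succ]
      refine S.smul_mem (S.sum_mem fun i hi => S.mul_mem (S.mul_mem ?_ ?_) ?_) _
      · exact S.pow_mem (S.neg_mem S.one_mem) _
      · exact h _ (by lia) (by have := Finset.mem_range.mp hi; lia)
      · exact ih _ (by lia) fun j h1 h2 => h j h1 (by lia)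

/-- The generating function of the elementary symmetric functions attached to a sequence of power
sums. -/
def newtonSeries : B⟦X⟧ := mk (newtonE k p)

@[simp]
theorem coeff_newtonSeries (s : ℕ) : coeff s (newtonSeries k p) = newtonE k p s := coeff_mk _ _

@[simp]
theorem constantCoeff_newtonSeries : constantCoeff (newtonSeries k p) = 1 := by
  rw [← coeff_zero_eq_constantCoeff_apply, coeff_newtonSeries, newtonE_zero]

/-- The alternating generating function `∑ (-1)ⁱ pᵢ₊₁ zⁱ` of a sequence of power sums, which is the
logarithmic derivative of `newtonSeries`. -/
def powerSumSeries : B⟦X⟧ := mk fun i => (-1) ^ i * p (i + 1)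

theorem powerSumSeries_add : powerSumSeries (p + q) = powerSumSeries p + powerSumSeries q := by
  ext i
  simp [powerSumSeries, mul_add]

variable [CharZero k]

theorem derivative_newtonSeries :
    d⁄dX B (newtonSeries k p) = powerSumSeries p * newtonSeries k p := by
  ext s
  have hs : ((s + 1 : ℕ) : k) ≠ 0 := Nat.cast_ne_zero.mpr s.succ_ne_zero
  rw [coeff_derivative, coeff_newtonSeries, newtonE_succ, smul_mul_assoc, inv_smul_eq_iff₀ hs,
    ← Nat.cast_succ, mul_comm, Algebra.smul_def, map_natCast, coeff_mul,
    Finset.Nat.sum_antidiagonal_eq_sum_range_succ_mk]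
  simp [powerSumSeries]

variable {p} in
theorem newtonSeries_eq_of_derivative_eq {F : B⟦X⟧} (hF : d⁄dX B F = powerSumSeries p * F)
    (h : constantCoeff F = 1) : newtonSeries k p = F := by
  have := IsAddTorsionFree.of_isTorsionFree k B
  exact eq_of_derivative_eq_mul (derivative_newtonSeries k p) hF
    ((constantCoeff_newtonSeries k p).trans h.symm)

theorem newtonSeries_add :
    newtonSeries k (p + q) = newtonSeries k p * newtonSeries k q := by
  refine newtonSeries_eq_of_derivative_eq k ?_ (by simp)
  rw [Derivation.leibniz, derivative_newtonSeries, derivative_newtonSeries, powerSumSeries_add,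
    smul_eq_mul, smul_eq_mul]
  ring

theorem newtonSeries_zero : newtonSeries k (0 : ℕ → B) = 1 := by
  refine newtonSeries_eq_of_derivative_eq k ?_ (by simp)
  ext
  simp [powerSumSeries]

theorem newtonSeries_pow (u : B) : newtonSeries k (fun j => u ^ j) = 1 + C u * X := by
  refine newtonSeries_eq_of_derivative_eq k ?_ (by simp)
  ext s
  cases s with
  | zero => simp [powerSumSeries]
  | succ s =>
    rw [mul_add, mul_one, ← mul_assoc, map_add (coeff _), coeff_succ_mul_X, coeff_mul_C]
    simp only [map_add, Derivation.map_one_eq_zero, Derivation.leibniz, derivative_X, smul_eq_mul,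
      mul_one, derivative_C, mul_zero, add_zero, zero_add, coeff_succ_C, powerSumSeries, coeff_mk]
    ring

theorem newtonSeries_sum_pow {ι : Type*} (t : Finset ι) (u : ι → B) :
    newtonSeries k (fun j => ∑ i ∈ t, u i ^ j) = ∏ i ∈ t, (1 + C (u i) * X) := by
  induction t using Finset.cons_induction with
  | empty => exact newtonSeries_zero k
  | cons i t hi ih =>
    simp only [Finset.sum_cons, Finset.prod_cons]
    rw [← newtonSeries_pow k, ← ih]
    exact newtonSeries_add k _ _

theorem newtonE_sum_pow {ι : Type*} (t : Finset ι) (u : ι → B) (s : ℕ) :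
    newtonE k (fun j => ∑ i ∈ t, u i ^ j) s = ∑ a ∈ t.powersetCard s, ∏ i ∈ a, u i := by
  classical
  rw [← coeff_newtonSeries, newtonSeries_sum_pow, Finset.prod_one_add, map_sum,
    Finset.powersetCard_eq_filter, Finset.sum_filter]
  refine Finset.sum_congr rfl fun a _ => ?_
  rw [Finset.prod_mul_distrib, Finset.prod_const, ← map_prod, coeff_C_mul, coeff_X_pow]
  simp [eq_comm]

theorem newtonSeries_sub_pow_mul (u : B) :
    newtonSeries k (fun j => p j - u ^ j) * (1 + C u * X) = newtonSeries k p := by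
  rw [← newtonSeries_pow k, ← newtonSeries_add]
  congr 1
  ext j
  simp

theorem newtonE_sub_pow (u : B) (s : ℕ) : newtonE k (fun j => p j - u ^ j) s =
    ∑ i ∈ Finset.range (s + 1), (-u) ^ i * newtonE k p (s - i) := by
  have hinv : (mk fun i => (-u) ^ i) * (1 + C u * X) = 1 := by
    ext s
    cases s with
    | zero => simp
    | succ s =>
      rw [mul_add, mul_one, ← mul_assoc, map_add (coeff _), coeff_succ_mul_X, coeff_mul_C]
      simp only [coeff_mk, coeff_one, Nat.add_eq_zero_iff, one_ne_zero, and_false, if_false]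
      ring
  have hseries : newtonSeries k (fun j => p j - u ^ j) =
      (mk fun i => (-u) ^ i) * newtonSeries k p := by
    rw [← newtonSeries_sub_pow_mul k p u, mul_left_comm, hinv, mul_one]
  rw [← coeff_newtonSeries, hseries, coeff_mul, Finset.Nat.sum_antidiagonal_eq_sum_range_succ_mk]
  simp

/-- In generating functions, `D E = Q E` with `Q' = D P`, because both sides solve
`F' = P F + (D P) E` with `F(0) = 0`. -/
theorem derivation_newtonE {d : ℕ → B} (D : Derivation k B B)
    (hd : ∀ i, D (p (i + 1)) = (i + 1) • d i) (s : ℕ) : D (newtonE k p (s + 1)) =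
      ∑ i ∈ Finset.range (s + 1), (-1) ^ i * d i * newtonE k p (s - i) := by
  have := IsAddTorsionFree.of_isTorsionFree k B
  set E := newtonSeries k p
  let P : B⟦X⟧ := powerSumSeries p
  let DE : B⟦X⟧ := mk fun s => D (newtonE k p s)
  let DP : B⟦X⟧ := mk fun i => (-1) ^ i * D (p (i + 1))
  let Q : B⟦X⟧ := X * mk fun i => (-1) ^ i * d i
  have hsign : ∀ (i : ℕ) (b : B), D ((-1) ^ i * b) = (-1) ^ i * D b := fun i b => by
    rcases neg_one_pow_eq_or B i with h | h <;> simp [h]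
  have hQ : d⁄dX B Q = DP := by
    ext i
    rw [coeff_derivative, coeff_succ_X_mul, coeff_mk, coeff_mk, hd, nsmul_eq_mul]
    push_cast
    ring
  have hDE : d⁄dX B DE = DP * E + P * DE := by
    ext s
    have hcoeff : D (coeff s (d⁄dX B E)) = D (coeff s (P * E)) := by
      rw [derivative_newtonSeries]
    rw [coeff_derivative, coeff_newtonSeries, coeff_mul, map_sum, ← Nat.cast_succ, mul_comm,
      ← nsmul_eq_mul, map_nsmul, nsmul_eq_mul, mul_comm, Nat.cast_succ] at hcoeff
    rw [coeff_derivative, coeff_mk, hcoeff, map_add, coeff_mul, coeff_mul,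
      ← Finset.sum_add_distrib]
    refine Finset.sum_congr rfl fun x _ => ?_
    simp only [E, P, DP, DE, powerSumSeries, coeff_mk, coeff_newtonSeries, Derivation.leibniz,
      hsign, smul_eq_mul]
    ring
  have hsub : DE - Q * E = 0 := by
    refine eq_of_derivative_eq_mul (P := P) ?_ (by simp) (by simp [DE, Q, newtonE_zero])
    rw [map_sub, hDE, Derivation.leibniz, hQ, derivative_newtonSeries, smul_eq_mul, smul_eq_mul]
    ring
  have hcoeff := congrArg (coeff (s + 1)) (sub_eq_zero.mp hsub)
  rw [mul_assoc, coeff_succ_X_mul, coeff_mk, coeff_mul,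
    Finset.Nat.sum_antidiagonal_eq_sum_range_succ_mk] at hcoeff
  simpa [E] using hcoeff

end NewtonE

/-! ### Symmetric polynomials and power sums -/

section PowerSums

theorem injective_of_surjective_ringEnd {R : Type*} [CommRing R] [IsNoetherianRing R]
    (f : R →+* R) (hf : Function.Surjective f) : Function.Injective f := by
  let F : ℕ →o Ideal R := ⟨fun n => RingHom.ker (f ^ n), monotone_nat_of_le_succ fun n x hx => by
    rw [RingHom.mem_ker] at hx ⊢
    rw [pow_succ', RingHom.mul_def, RingHom.comp_apply, hx, map_zero]⟩
  obtain ⟨n, hn⟩ := monotone_stabilizes_iff_noetherian.mpr ‹IsNoetherian R R› F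
  refine (injective_iff_map_eq_zero f).mpr fun x hx => ?_
  obtain ⟨y, rfl⟩ : ∃ y, (f ^ n) y = x := by
    rw [RingHom.coe_pow]
    exact hf.iterate n x
  have hy : y ∈ F (n + 1) := by
    change (f ^ (n + 1)) y = 0
    rwa [pow_succ', RingHom.mul_def, RingHom.comp_apply]
  rwa [← hn (n + 1) n.le_succ] at hy

variable {k : Type*} [Field k]

theorem mem_of_forall_sum_pow_smul_mem [Infinite k] {E : Type*} [AddCommGroup E] [Module k E]
    {S : Submodule k E} {N : ℕ} {v : ℕ → E}
    (h : ∀ s : k, ∑ i ∈ Finset.range N, s ^ i • v i ∈ S) {i : ℕ} (hi : i < N) : v i ∈ S := by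
  by_contra hv
  obtain ⟨f, hf, hS⟩ := Submodule.exists_le_ker_of_notMem hv
  let p : Polynomial k := ∑ j ∈ Finset.range N, Polynomial.monomial j (f (v j))
  have hp : p = 0 := Polynomial.funext fun s => by
    have hs : f (∑ j ∈ Finset.range N, s ^ j • v j) = 0 := hS (h s)
    simpa [p, Polynomial.eval_finsetSum, mul_comm] using hs
  refine hf ?_
  simpa [p, Polynomial.finsetSum_coeff, Polynomial.coeff_monomial, hi] using
    congrArg (Polynomial.coeff · i) hp

/-- The ring of symmetric polynomials in `m` variables. -/
abbrev SymPoly (k : Type*) [Field k] (m : ℕ) : Type _ := MvPolynomial.symmetricSubalgebra (Fin m) k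

theorem coe_newton (m j : ℕ) : (newton k m j : MvPolynomial (Fin m) k) =
    MvPolynomial.psum (Fin m) k j := rfl

/-- The linear map `a ↦ a(x₁) + ⋯ + a(xₘ)`. -/
def powerSum (k : Type*) [Field k] (m : ℕ) : Polynomial k →ₗ[k] SymPoly k m where
  toFun a := ⟨∑ i, Polynomial.aeval (MvPolynomial.X i) a, fun e => by
    rw [map_sum]
    refine Fintype.sum_equiv e _ _ fun i => ?_
    rw [← Polynomial.aeval_algHom_apply, MvPolynomial.rename_X]⟩
  map_add' a b := Subtype.ext (by simp [Finset.sum_add_distrib])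
  map_smul' c a := Subtype.ext (by simp [Finset.smul_sum])

theorem coe_powerSum (m : ℕ) (a : Polynomial k) : (powerSum k m a : MvPolynomial (Fin m) k) =
    ∑ i, Polynomial.aeval (MvPolynomial.X i) a := rfl

theorem powerSum_X_pow (m j : ℕ) : powerSum k m (Polynomial.X ^ j) = newton k m j :=
  Subtype.ext (by simp [coe_powerSum, coe_newton, MvPolynomial.psum])

theorem powerSum_one (m : ℕ) : powerSum k m 1 = m :=
  Subtype.ext (by simp [coe_powerSum])

/-- The monoid homomorphism `a ↦ a(x₁) ⋯ a(xₘ)`. -/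
def powerProd (k : Type*) [Field k] (m : ℕ) : Polynomial k →* SymPoly k m where
  toFun a := ⟨∏ i, Polynomial.aeval (MvPolynomial.X i) a, fun e => by
    rw [map_prod]
    refine Fintype.prod_equiv e _ _ fun i => ?_
    rw [← Polynomial.aeval_algHom_apply, MvPolynomial.rename_X]⟩
  map_one' := Subtype.ext (by simp)
  map_mul' a b := Subtype.ext (by simp [Finset.prod_mul_distrib])

theorem coe_powerProd (m : ℕ) (a : Polynomial k) : (powerProd k m a : MvPolynomial (Fin m) k) =
    ∏ i, Polynomial.aeval (MvPolynomial.X i) a := rfl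

/-- The elementary symmetric polynomial of degree `d`, as an element of the ring of symmetric
polynomials. -/
def elementary (k : Type*) [Field k] (m d : ℕ) : SymPoly k m :=
  ⟨MvPolynomial.esymm (Fin m) k d, MvPolynomial.esymm_isSymmetric (Fin m) k d⟩

theorem coe_elementary (m d : ℕ) : (elementary k m d : MvPolynomial (Fin m) k) =
    MvPolynomial.esymm (Fin m) k d := rfl

theorem SymPoly.subalgebra_eq_top_of_elementary_mem {m : ℕ} {S : Subalgebra k (SymPoly k m)}
    (hS : ∀ d, d ≤ m → elementary k m d ∈ S) : S = ⊤ := by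
  refine eq_top_iff.mpr fun x _ => ?_
  obtain ⟨q, rfl⟩ := (MvPolynomial.esymmAlgEquiv (Fin m) k (Fintype.card_fin m)).surjective x
  have hrange : (MvPolynomial.esymmAlgHom (Fin m) k m).range ≤ S := by
    rw [MvPolynomial.esymmAlgHom, ← Algebra.adjoin_range_eq_range_aeval]
    refine Algebra.adjoin_le ?_
    rintro _ ⟨i, rfl⟩
    exact hS (i + 1) (by lia)
  exact hrange ⟨q, rfl⟩

theorem span_powerProd [Infinite k] (m : ℕ) :
    Submodule.span k (Set.range (powerProd k m)) = ⊤ := by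
  have hprod : ∀ s : k, (powerProd k m (1 + s • Polynomial.X) : MvPolynomial (Fin m) k) =
      ∑ d ∈ Finset.range (m + 1), s ^ d • MvPolynomial.esymm (Fin m) k d := fun s => by
    rw [coe_powerProd]
    simp only [map_add, map_one, map_smul, Polynomial.aeval_X]
    rw [Finset.prod_one_add, Finset.sum_powerset]
    simp only [Finset.card_univ, Fintype.card_fin, MvPolynomial.esymm, Finset.smul_sum]
    refine Finset.sum_congr rfl fun d _ => Finset.sum_congr rfl fun t ht => ?_
    rw [← (Finset.mem_powersetCard.mp ht).2, Finset.prod_smul, Finset.prod_const]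
  have helem : ∀ d, d ≤ m → elementary k m d ∈ Submodule.span k (Set.range (powerProd k m)) :=
    fun d hd => by
      have hmem : ∀ s : k, ∑ d ∈ Finset.range (m + 1), s ^ d • elementary k m d ∈
          Submodule.span k (Set.range (powerProd k m)) := fun s =>
        Submodule.subset_span ⟨1 + s • Polynomial.X, Subtype.ext (by simp [hprod, coe_elementary])⟩
      exact mem_of_forall_sum_pow_smul_mem hmem (Nat.lt_succ_of_le hd)
  have hadj : Subalgebra.toSubmodule (Algebra.adjoin k (Set.range (powerProd k m))) =
      Submodule.span k (Set.range (powerProd k m)) := by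
    rw [Algebra.adjoin_eq_span, ← MonoidHom.coe_mrange, Submonoid.closure_eq]
  rw [← hadj] at helem ⊢
  rw [SymPoly.subalgebra_eq_top_of_elementary_mem helem, Algebra.top_toSubmodule]

/-- The polynomial ring in `m` variables maps to the symmetric polynomials by sending the variables
to the first `m` power sums. -/
def psumHom (k : Type*) [Field k] (m : ℕ) : MvPolynomial (Fin m) k →ₐ[k] SymPoly k m :=
  MvPolynomial.aeval fun i : Fin m => newton k m (i + 1)

theorem psumHom_X {m j : ℕ} (h : j < m) :
    psumHom k m (MvPolynomial.X ⟨j, h⟩) = newton k m (j + 1) := by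
  rw [psumHom, MvPolynomial.aeval_X]

variable [CharZero k]

theorem newtonE_powerSum (m : ℕ) (a : Polynomial k) (s : ℕ) :
    ((newtonE k (fun j => powerSum k m (a ^ j)) s : SymPoly k m) : MvPolynomial (Fin m) k) =
      ∑ t ∈ Finset.univ.powersetCard s, ∏ i ∈ t, Polynomial.aeval (MvPolynomial.X i) a := by
  rw [← newtonE_sum_pow k]
  refine (map_newtonE k _ (MvPolynomial.symmetricSubalgebra (Fin m) k).val s).trans ?_
  simp [coe_powerSum]

theorem newtonE_powerSum_eq_zero {m s : ℕ} (a : Polynomial k) (h : m < s) :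
    newtonE k (fun j => powerSum k m (a ^ j)) s = 0 :=
  Subtype.ext (by
    rw [newtonE_powerSum, Finset.powersetCard_eq_empty.mpr (by simpa using h)]
    simp)

theorem newtonE_newton (m s : ℕ) : newtonE k (newton k m) s = elementary k m s := by
  have h := newtonE_powerSum (k := k) m Polynomial.X s
  simp only [powerSum_X_pow, Polynomial.aeval_X] at h
  exact Subtype.ext h

theorem SymPoly.subalgebra_eq_top_of_newton_mem {m : ℕ} {S : Subalgebra k (SymPoly k m)}
    (hS : ∀ j, 1 ≤ j → j ≤ m → newton k m j ∈ S) : S = ⊤ :=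
  SymPoly.subalgebra_eq_top_of_elementary_mem fun d hd => by
    rw [← newtonE_newton]
    exact newtonE_mem fun j hj hjd => hS j hj (hjd.trans hd)

theorem psumHom_surjective (m : ℕ) : Function.Surjective (psumHom k m) := by
  rw [← AlgHom.range_eq_top]
  refine SymPoly.subalgebra_eq_top_of_newton_mem fun j hj hjm => ?_
  obtain ⟨j, rfl⟩ := Nat.exists_eq_add_of_le' hj
  exact ⟨_, psumHom_X hjm⟩

/-- Composed with the isomorphism of the fundamental theorem, `psumHom` is a surjective endomorphism
of a Noetherian ring. -/
theorem psumHom_bijective (m : ℕ) : Function.Bijective (psumHom k m) := by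
  let e := MvPolynomial.esymmAlgEquiv (Fin m) k (Fintype.card_fin m)
  have h : Function.Injective (e.symm ∘ psumHom k m) := injective_of_surjective_ringEnd
    (e.symm.toAlgHom.comp (psumHom k m)).toRingHom
    (e.symm.surjective.comp (psumHom_surjective m))
  exact ⟨h.of_comp, psumHom_surjective m⟩

theorem SymPoly.exists_algHom {m : ℕ} {B : Type*} [CommRing B] [Algebra k B]
    (b : ℕ → B) : ∃ f : SymPoly k m →ₐ[k] B, ∀ j, 1 ≤ j → j ≤ m → f (newton k m j) = b j := by
  let e := AlgEquiv.ofBijective (psumHom k m) (psumHom_bijective m)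
  refine ⟨(MvPolynomial.aeval fun i : Fin m => b (i + 1)).comp e.symm.toAlgHom, fun j hj hjm => ?_⟩
  obtain ⟨j, rfl⟩ := Nat.exists_eq_add_of_le' hj
  have he : e.symm (newton k m (j + 1)) = MvPolynomial.X ⟨j, hjm⟩ :=
    e.symm_apply_eq.mpr (psumHom_X hjm).symm
  change MvPolynomial.aeval _ (e.symm (newton k m (j + 1))) = _
  rw [he, MvPolynomial.aeval_X]

theorem SymPoly.algHom_ext {m : ℕ} {B : Type*} [Semiring B] [Algebra k B]
    {f g : SymPoly k m →ₐ[k] B} (h : ∀ j, 1 ≤ j → j ≤ m → f (newton k m j) = g (newton k m j)) :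
    f = g :=
  (AlgHom.equalizer_eq_top).mp (SymPoly.subalgebra_eq_top_of_newton_mem h)

end PowerSums

/-! ### Homomorphisms out of the ring of symmetric polynomials -/

section Universal

variable {k : Type*} [Field k] {B : Type*} [CommRing B] [Algebra k B]

theorem eq_zero_of_forall_eval_algebraMap [Infinite k] {p : Polynomial B}
    (h : ∀ s : k, p.eval (algebraMap k B s) = 0) : p = 0 := by
  ext i
  by_cases hi : i < p.natDegree + 1
  · refine (Submodule.mem_bot k).mp (mem_of_forall_sum_pow_smul_mem (fun s => ?_) hi)
    rw [Submodule.mem_bot, ← h s, Polynomial.eval_eq_sum_range]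
    refine Finset.sum_congr rfl fun j _ => ?_
    rw [Algebra.smul_def, map_pow, mul_comm]
  · exact Polynomial.coeff_eq_zero_of_natDegree_lt (by lia)

/-- The polynomial in `s` whose value is `τ ((t + s t ^ r) ^ j)`. -/
def deform (τ : Polynomial k →ₗ[k] B) (r j : ℕ) : Polynomial B :=
  ∑ i ∈ Finset.range (j + 1), Polynomial.monomial i
    (τ (j.choose i • Polynomial.X ^ (j - i + r * i)))

theorem eval_deform (τ : Polynomial k →ₗ[k] B) (r j : ℕ) (s : k) :
    (deform τ r j).eval (algebraMap k B s) =
      τ ((Polynomial.X + s • Polynomial.X ^ r) ^ j) := by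
  rw [deform, Polynomial.eval_finsetSum, add_comm (Polynomial.X : Polynomial k), add_pow, map_sum]
  refine Finset.sum_congr rfl fun i _ => ?_
  rw [Polynomial.eval_monomial, ← map_pow, mul_comm, ← Algebra.smul_def, ← map_smul]
  congr 1
  rw [smul_pow, ← pow_mul, smul_mul_assoc, smul_mul_assoc, ← pow_add, nsmul_eq_mul, mul_comm,
    add_comm]

theorem coeff_deform_zero (τ : Polynomial k →ₗ[k] B) (r j : ℕ) :
    (deform τ r j).coeff 0 = τ (Polynomial.X ^ j) := by
  simp [deform, Polynomial.finsetSum_coeff, Polynomial.coeff_monomial]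

theorem coeff_deform_succ_one (τ : Polynomial k →ₗ[k] B) (r j : ℕ) :
    (deform τ r (j + 1)).coeff 1 = (j + 1) • τ (Polynomial.X ^ (j + r)) := by
  simp only [deform, Polynomial.finsetSum_coeff, Polynomial.coeff_monomial, Finset.sum_ite_eq',
    Finset.mem_range]
  rw [if_pos (by lia), Nat.choose_one_right, mul_one, Nat.add_sub_cancel, map_nsmul]

variable [CharZero k]

theorem newtonE_deform_eq_zero {m : ℕ} {τ : Polynomial k →ₗ[k] B}
    (hτ : ∀ a : Polynomial k, newtonE k (fun j => τ (a ^ j)) m = 0) (r : ℕ) :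
    newtonE k (deform τ r) m = 0 :=
  eq_zero_of_forall_eval_algebraMap fun s => by
    have h := map_newtonE k (deform τ r)
      ((Polynomial.aeval (algebraMap k B s) : Polynomial B →ₐ[B] B).restrictScalars k) m
    simp only [AlgHom.restrictScalars_apply, Polynomial.coe_aeval_eq_eval, eval_deform] at h
    exact h.trans (hτ _)

/-- The coefficient of `s` in the relation for `a = t + s t ^ r`. -/
theorem sum_newtonE_mul_eq_zero {m : ℕ} {τ : Polynomial k →ₗ[k] B}
    (hτ : ∀ a : Polynomial k, newtonE k (fun j => τ (a ^ j)) (m + 1) = 0) (r : ℕ) :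
    ∑ i ∈ Finset.range (m + 1), (-1) ^ i * τ (Polynomial.X ^ (i + r)) *
      newtonE k (fun j => τ (Polynomial.X ^ j)) (m - i) = 0 := by
  let D : Derivation k (Polynomial B) (Polynomial B) :=
    (Polynomial.derivative' (R := B)).restrictScalars k
  let d : ℕ → Polynomial B := fun i => ((i + 1 : ℕ) : k)⁻¹ • D (deform τ r (i + 1))
  let ev : Polynomial B →ₐ[k] B := (Polynomial.aeval (0 : B)).restrictScalars k
  have hd : ∀ i, D (deform τ r (i + 1)) = (i + 1) • d i := fun i => by
    rw [← Nat.cast_smul_eq_nsmul k, smul_inv_smul₀ (Nat.cast_ne_zero.mpr i.succ_ne_zero)]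
  have hev : ∀ p, ev p = p.coeff 0 := fun p => (Polynomial.coeff_zero_eq_aeval_zero p).symm
  have hevd : ∀ i, ev (d i) = τ (Polynomial.X ^ (i + r)) := fun i => by
    have hD : ev (D (deform τ r (i + 1))) = ((i + 1 : ℕ) : k) • τ (Polynomial.X ^ (i + r)) := by
      rw [hev, Nat.cast_smul_eq_nsmul, ← coeff_deform_succ_one]
      exact (Polynomial.coeff_derivative _ 0).trans (by simp)
    rw [map_smul, hD, inv_smul_smul₀ (Nat.cast_ne_zero.mpr i.succ_ne_zero)]
  have h := congrArg ev (derivation_newtonE k (deform τ r) D hd m)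
  rw [newtonE_deform_eq_zero hτ, map_zero, map_zero, map_sum] at h
  simp only [map_mul, map_pow, map_neg, map_one, map_newtonE, hevd] at h
  simp only [hev, coeff_deform_zero] at h
  exact h.symm

/-- The relations for `a = t + s t ^ r`, to first order in `s`, determine all `τ (t ^ j)` from those
with `j ≤ m`. -/
theorem SymPoly.exists_algHom_of_newtonE {m : ℕ} (τ : Polynomial k →ₗ[k] B)
    (h1 : τ 1 = m) (hτ : ∀ a : Polynomial k, newtonE k (fun j => τ (a ^ j)) (m + 1) = 0) :
    ∃ θ : SymPoly k m →ₐ[k] B, ∀ a, θ (powerSum k m a) = τ a := by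
  obtain ⟨θ, hθ⟩ := SymPoly.exists_algHom (k := k) (m := m) fun j => τ (Polynomial.X ^ j)
  refine ⟨θ, fun a => ?_⟩
  suffices h : ∀ j, θ (newton k m j) = τ (Polynomial.X ^ j) by
    refine LinearMap.congr_fun (f := θ.toLinearMap ∘ₗ powerSum k m) (g := τ)
      ((Polynomial.basisMonomials k).ext fun j => ?_) a
    simpa [← Polynomial.X_pow_eq_monomial, powerSum_X_pow] using h j
  intro j
  induction j using Nat.strong_induction_on with
  | _ j ih =>
    rcases Nat.eq_zero_or_pos j with rfl | hj
    · rw [pow_zero, h1, ← powerSum_X_pow, pow_zero, powerSum_one, map_natCast]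
    rcases Nat.lt_or_ge m j with hm | hm
    · obtain ⟨r, rfl⟩ := Nat.exists_eq_add_of_le hm.le
      have hE : ∀ i, θ (newtonE k (newton k m) (m - i)) =
          newtonE k (fun j => τ (Polynomial.X ^ j)) (m - i) := fun i => by
        rw [map_newtonE]
        exact newtonE_congr fun j hj hjm => ih j (by lia)
      have hF := congrArg θ (sum_newtonE_mul_eq_zero (τ := powerSum k m)
        (fun a => newtonE_powerSum_eq_zero a m.lt_succ_self) r)
      simp only [powerSum_X_pow, map_sum, map_mul, map_pow, map_neg, map_one, map_zero, hE] at hF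
      have hB := sum_newtonE_mul_eq_zero hτ r
      rw [Finset.sum_range_succ] at hF hB
      rw [Finset.sum_congr rfl fun i hi => by rw [ih (i + r) (by grind)], ← hB, add_left_cancel_iff,
        Nat.sub_self, newtonE_zero, mul_one, mul_one] at hF
      exact ((isUnit_one.neg.pow m).mul_left_cancel hF)
    · exact hθ j hj hm

end Universal

/-! ### Power sums over the cycles of permutations -/

section CycleIndex

open Equiv.Perm

variable {α : Type*} [Fintype α] [DecidableEq α]

/-- The cycles of `g`, including the fixed points. -/
abbrev Cycles (g : Equiv.Perm α) : Type _ := g.cycleFactorsFinset ⊕ (g.supportᶜ : Finset α)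

/-- The cycle of `g` that contains `x`. -/
def toCycle (g : Equiv.Perm α) (x : α) : Cycles g :=
  if h : x ∈ g.support then Sum.inl ⟨g.cycleOf x, cycleOf_mem_cycleFactorsFinset_iff.mpr h⟩
  else Sum.inr ⟨x, Finset.mem_compl.mpr h⟩

theorem toCycle_eq_inl (g : Equiv.Perm α) (x : α) (c : g.cycleFactorsFinset) :
    toCycle g x = Sum.inl c ↔ x ∈ (c : Equiv.Perm α).support := by
  unfold toCycle
  split_ifs with h
  · rw [Sum.inl.injEq, Subtype.ext_iff]
    constructor
    · rintro h'
      rw [← h']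
      exact mem_support_cycleOf_iff.mpr ⟨SameCycle.refl _ _, h⟩
    · exact fun h' => (cycle_is_cycleOf h' c.2).symm
  · exact iff_of_false (by simp) fun h' => h (mem_cycleFactorsFinset_support_le c.2 h')

theorem toCycle_eq_inr (g : Equiv.Perm α) (x : α) (y : (g.supportᶜ : Finset α)) :
    toCycle g x = Sum.inr y ↔ x = y := by
  unfold toCycle
  split_ifs with h
  · refine iff_of_false (by simp) ?_
    rintro rfl
    exact Finset.mem_compl.mp y.2 h
  · rw [Sum.inr.injEq, Subtype.ext_iff]

theorem toCycle_surjective (g : Equiv.Perm α) : Function.Surjective (toCycle g) := by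
  rintro (c | y)
  · obtain ⟨x, hx⟩ := (mem_cycleFactorsFinset_iff.mp c.2).1.nonempty_support
    exact ⟨x, (toCycle_eq_inl g x c).mpr hx⟩
  · exact ⟨y, (toCycle_eq_inr g y y).mpr rfl⟩

theorem toCycle_apply (g : Equiv.Perm α) (x : α) : toCycle g (g x) = toCycle g x := by
  rcases h : toCycle g x with c | y
  · rw [toCycle_eq_inl] at h ⊢
    rw [← (mem_cycleFactorsFinset_iff.mp c.2).2 x h]
    exact apply_mem_support.mpr h
  · rw [toCycle_eq_inr] at h ⊢
    rw [h, notMem_support.mp (Finset.mem_compl.mp y.2)]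

theorem sameCycle_of_toCycle_eq {g : Equiv.Perm α} {x y : α} (h : toCycle g x = toCycle g y) :
    g.SameCycle x y := by
  rcases hy : toCycle g y with c | z
  · rw [hy, toCycle_eq_inl] at h
    rw [toCycle_eq_inl] at hy
    rw [sameCycle_iff_cycleOf_eq_of_mem_support (mem_cycleFactorsFinset_support_le c.2 h)
      (mem_cycleFactorsFinset_support_le c.2 hy), ← cycle_is_cycleOf h c.2,
      ← cycle_is_cycleOf hy c.2]
  · rw [hy, toCycle_eq_inr] at h
    rw [toCycle_eq_inr] at hy
    rw [h, hy]

theorem prod_parts_partition {C : Type*} [CommMonoid C] (g : Equiv.Perm α) (p : ℕ → C) :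
    (g.partition.parts.map p).prod =
      ∏ o : Cycles g, p (Finset.univ.filter fun x => toCycle g x = o).card := by
  rw [parts_partition, Multiset.map_add, Multiset.prod_add, Multiset.map_replicate,
    Multiset.prod_replicate, Fintype.prod_sum_type]
  congr 1
  · rw [cycleType_def, Multiset.map_map]
    change ∏ c ∈ g.cycleFactorsFinset, p c.support.card = _
    rw [← Finset.prod_coe_sort]
    refine Finset.prod_congr rfl fun c _ => ?_
    simp only [toCycle_eq_inl, Finset.filter_univ_mem]
  · simp only [toCycle_eq_inr, Finset.filter_eq', Finset.mem_univ, if_true, Finset.card_singleton,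
      Finset.prod_const, Finset.card_univ, Fintype.card_coe, Finset.card_compl]

end CycleIndex

section SignedSum

open Equiv.Perm

theorem eq_of_sameCycle_of_comp_eq {α ι : Type*} {f : α → ι} {g : Equiv.Perm α} (hf : f ∘ g = f)
    {x y : α} (h : g.SameCycle x y) : f x = f y := by
  obtain ⟨i, rfl⟩ := h
  have hi : DomMulAct.mk (g ^ i) ∈ MulAction.stabilizer (Equiv.Perm α)ᵈᵐᵃ f := by
    rw [DomMulAct.mk_zpow]
    exact zpow_mem (DomMulAct.mem_stabilizer_iff.mpr hf) i
  exact (congrFun (DomMulAct.mem_stabilizer_iff.mp hi) x).symm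

variable {α ι : Type*} [Fintype α] [DecidableEq α] [DecidableEq ι]

theorem prod_parts_powerSum {C : Type*} [CommSemiring C] [Fintype ι]
    (g : Equiv.Perm α) (y : ι → C) : (g.partition.parts.map fun j => ∑ i, y i ^ j).prod =
      ∑ f : α → ι, if f ∘ g = f then ∏ x, y (f x) else 0 := by
  rw [prod_parts_partition, Finset.prod_univ_sum, Fintype.piFinset_univ, ← Finset.sum_filter]
  refine Finset.sum_bij (fun φ _ => φ ∘ toCycle g) (fun φ _ => ?_)
    (fun φ _ ψ _ h => (toCycle_surjective g).injective_comp_right h) (fun f hf => ?_) fun φ _ => ?_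
  · rw [Finset.mem_filter]
    exact ⟨Finset.mem_univ _, funext fun x => congrArg φ (toCycle_apply g x)⟩
  · let s := Function.surjInv (toCycle_surjective g)
    refine ⟨f ∘ s, Finset.mem_univ _, funext fun x => ?_⟩
    exact eq_of_sameCycle_of_comp_eq (Finset.mem_filter.mp hf).2
      (sameCycle_of_toCycle_eq (Function.surjInv_eq (toCycle_surjective g) (toCycle g x)))
  · rw [← Finset.prod_fiberwise_of_maps_to (g := toCycle g) (t := Finset.univ)
      fun _ _ => Finset.mem_univ _]
    refine Finset.prod_congr rfl fun o _ => ?_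
    rw [← Finset.prod_const]
    refine Finset.prod_congr rfl fun x hx => ?_
    rw [Function.comp_apply, (Finset.mem_filter.mp hx).2]

/-- Multiplying by a transposition of two points with the same image pairs off the terms with
opposite signs. -/
theorem sum_sign_eq_zero_of_not_injective {f : α → ι} (hf : ¬ Function.Injective f) :
    ∑ g : Equiv.Perm α, (if f ∘ g = f then (sign g : ℤ) else 0) = 0 := by
  obtain ⟨a, b, hfab, hab⟩ := Function.not_injective_iff.mp hf
  have hswap : f ∘ Equiv.swap a b = f := by
    rw [Equiv.comp_swap_eq_update, hfab, Function.update_eq_self, ← hfab,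
      Function.update_eq_self]
  refine Finset.sum_involution (fun g _ => Equiv.swap a b * g) (fun g _ => ?_) (fun g _ _ h => ?_)
    (fun _ _ => Finset.mem_univ _) fun g _ => Equiv.swap_mul_self_mul a b g
  · rw [coe_mul, ← Function.comp_assoc, hswap, map_mul, sign_swap hab]
    split_ifs <;> simp
  · exact hab (Equiv.swap_eq_one_iff.mp (mul_eq_right.mp h))

theorem sum_sign_eq_one_of_injective {f : α → ι} (hf : Function.Injective f) :
    ∑ g : Equiv.Perm α, (if f ∘ g = f then (sign g : ℤ) else 0) = 1 := by
  have hone : ∀ g : Equiv.Perm α, g ≠ 1 → f ∘ g ≠ f := fun g h hg =>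
    h (Equiv.ext fun x => hf (congrFun hg x))
  rw [Finset.sum_eq_single_of_mem 1 (Finset.mem_univ _) fun g _ h => if_neg (hone g h)]
  simp

theorem sum_sign_smul_prod_parts_powerSum {C : Type*} [CommRing C] (y : α → C) :
    ∑ g : Equiv.Perm α, (sign g : ℤ) • (g.partition.parts.map fun j => ∑ i, y i ^ j).prod =
      (Fintype.card α).factorial • ∏ i, y i := by
  have hsum : ∀ f : α → α, ∑ g : Equiv.Perm α, (sign g : ℤ) •
      (if f ∘ g = f then ∏ x, y (f x) else 0) =
      if Function.Bijective f then ∏ i, y i else 0 := fun f => by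
    have hterm : ∀ g : Equiv.Perm α, (sign g : ℤ) • (if f ∘ g = f then ∏ x, y (f x) else 0) =
        (if f ∘ g = f then (sign g : ℤ) else 0) • ∏ x, y (f x) := fun g => by
      rw [smul_ite, smul_zero, ite_smul, zero_smul]
    simp only [hterm, ← Finset.sum_smul]
    split_ifs with h
    · rw [sum_sign_eq_one_of_injective h.injective, one_smul, h.prod_comp]
    · rw [sum_sign_eq_zero_of_not_injective (mt Finite.injective_iff_bijective.mp h), zero_smul]
  simp only [prod_parts_powerSum, Finset.smul_sum]
  rw [Finset.sum_comm, Finset.sum_congr rfl fun f _ => hsum f, ← Finset.sum_filter,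
    Finset.sum_const, ← Fintype.card_subtype, ← Fintype.card_perm]
  congr 1
  exact Fintype.card_congr Equiv.bijectiveEquiv

/-- The cycle type of a permutation of `Fin N`, as a partition of `N`. -/
def finPartition {N : ℕ} (g : Equiv.Perm (Fin N)) : N.Partition where
  parts := g.partition.parts
  parts_pos := g.partition.parts_pos
  parts_sum := g.partition.parts_sum.trans (Fintype.card_fin N)

theorem sign_eq_sgn {N : ℕ} (g : Equiv.Perm (Fin N)) : (sign g : ℤ) = sgn (finPartition g) := by
  have hcard : N + (Multiset.card g.cycleType + (N - g.support.card)) =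
      g.support.card + Multiset.card g.cycleType + 2 * (N - g.support.card) := by
    have h : g.support.card ≤ N := by simpa using Finset.card_le_univ g.support
    lia
  rw [sign_of_cycleType, sgn, finPartition, parts_partition, Multiset.card_add,
    Multiset.card_replicate, sum_cycleType, Fintype.card_fin, hcard, pow_add _ _ (2 * _), pow_mul]
  simp

theorem sum_partition_eq_sum_perm {N : ℕ} {C : Type*} [CommRing C] (p : ℕ → C) :
    ∑ σ : N.Partition, (sgn σ * classCard σ) • (σ.parts.map p).prod =
      ∑ g : Equiv.Perm (Fin N), (sign g : ℤ) • (g.partition.parts.map p).prod := by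
  rw [← Finset.sum_fiberwise_of_maps_to (g := finPartition) (t := Finset.univ)
    fun _ _ => Finset.mem_univ _]
  refine Finset.sum_congr rfl fun σ _ => ?_
  have hterm : ∀ g ∈ Finset.univ.filter (fun g : Equiv.Perm (Fin N) => finPartition g = σ),
      (sign g : ℤ) • (g.partition.parts.map p).prod = sgn σ • (σ.parts.map p).prod := by
    intro g hg
    rw [sign_eq_sgn, ← Finset.mem_filter_univ _ |>.mp hg]
    rfl
  rw [Finset.sum_congr rfl hterm, Finset.sum_const, mul_comm, mul_smul, natCast_zsmul, classCard,
    Nat.card_eq_fintype_card, Fintype.card_subtype]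
  simp only [finPartition, Nat.Partition.ext_iff]

/-- The power sums of `N` variables are algebraically independent, so it is enough to check this
identity for them. -/
theorem sum_partition_eq_factorial_smul_newtonE (k : Type*) [Field k] [CharZero k] {B : Type*}
    [CommRing B] [Algebra k B] (N : ℕ) (p : ℕ → B) :
    ∑ σ : N.Partition, (sgn σ * classCard σ) • (σ.parts.map p).prod =
      N.factorial • newtonE k p N := by
  have huniv : ∑ σ : N.Partition, (sgn σ * classCard σ) • (σ.parts.map (newton k N)).prod =
      N.factorial • newtonE k (newton k N) N := by
    refine Subtype.ext ?_
    rw [sum_partition_eq_sum_perm, newtonE_newton]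
    have h := sum_sign_smul_prod_parts_powerSum fun i : Fin N => (MvPolynomial.X i :
      MvPolynomial (Fin N) k)
    have hcoe : ∀ g : Equiv.Perm (Fin N),
        ((g.partition.parts.map (newton k N)).prod : MvPolynomial (Fin N) k) =
          (g.partition.parts.map fun j => ∑ i, MvPolynomial.X i ^ j).prod := fun g => by
      rw [← Subalgebra.coe_val, map_multiset_prod, Multiset.map_map]
      rfl
    have hesymm : MvPolynomial.esymm (Fin N) k N = ∏ i, MvPolynomial.X i := by
      have hN : Finset.univ.powersetCard N = {(Finset.univ : Finset (Fin N))} := by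
        simpa using Finset.powersetCard_self (Finset.univ : Finset (Fin N))
      rw [MvPolynomial.esymm, hN, Finset.sum_singleton]
    simp only [AddSubmonoidClass.coe_finsetSum, AddSubgroupClass.coe_zsmul, hcoe]
    rw [h]
    simp [coe_elementary, hesymm]
  obtain ⟨θ, hθ⟩ := SymPoly.exists_algHom (k := k) (m := N) p
  have h := congrArg θ huniv
  rw [map_sum, map_nsmul, map_newtonE, newtonE_congr hθ] at h
  rw [← h]
  refine Finset.sum_congr rfl fun σ _ => ?_
  rw [map_zsmul, map_multiset_prod, Multiset.map_map]
  congr 2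
  exact Multiset.map_congr rfl fun j hj =>
    (hθ j (σ.parts_pos hj) (σ.le_of_mem_parts hj)).symm

end SignedSum

/-! ### The envelope of the polynomial ring in one variable -/

section EnvelopePolynomial

attribute [local instance 100] LieRing.ofAssociativeRing

theorem map_partTensor {k A C : Type*} [Field k] [CommRing A] [Algebra k A] [CommSemiring C]
    [Algebra k C] (f : TensorAlgebra k A →ₐ[k] C) {N : ℕ} (σ : N.Partition) (a : A) :
    f (partTensor k σ a) = (σ.parts.map fun i => f (TensorAlgebra.ι k (a ^ i))).prod := by
  rw [partTensor, map_list_prod, List.map_map]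
  conv_rhs => rw [← Multiset.sort_eq σ.parts (· ≥ ·)]
  rfl

section Relations

variable {k : Type*} [Field k] {A : Type*} [CommRing A] [Algebra k A] (n : ℕ)

theorem Envelope.adjoin_range_of : Algebra.adjoin k (Set.range (Envelope.of k A n)) = ⊤ := by
  have h : Set.range (Envelope.of k A n) =
      RingQuot.mkAlgHom k (EnvRel k n) '' Set.range (TensorAlgebra.ι k) :=
    Set.range_comp (RingQuot.mkAlgHom k (EnvRel k n)) (TensorAlgebra.ι k)
  rw [h, ← AlgHom.map_adjoin, TensorAlgebra.adjoin_range_ι, Algebra.map_top,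
    (AlgHom.range_eq_top _).mpr (RingQuot.mkAlgHom_surjective k _)]

theorem Envelope.of_one : Envelope.of k A n 1 = n :=
  (RingQuot.mkAlgHom_rel k EnvRel.level).trans (map_natCast _ n)

theorem Envelope.lie_of_of_sq (a : A) :
    ⁅Envelope.of k A n a, Envelope.of k A n (a ^ 2)⁆ = 0 := by
  have h := RingQuot.mkAlgHom_rel k (EnvRel.jordan (k := k) (n := n) a)
  rwa [map_mul, map_mul, ← sub_eq_zero] at h

/-- The full polarization of `[a, a²] = 0`. -/
theorem Envelope.lie_of_of_mul_cyclic [CharZero k] (a b c : A) :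
    ⁅Envelope.of k A n a, Envelope.of k A n (b * c)⁆ +
      ⁅Envelope.of k A n b, Envelope.of k A n (c * a)⁆ +
      ⁅Envelope.of k A n c, Envelope.of k A n (a * b)⁆ = 0 := by
  set o := Envelope.of k A n
  have hsq : ∀ x : A, ⁅o x, o (x ^ 2)⁆ = 0 := Envelope.lie_of_of_sq n
  have hadd : ∀ x y : A, o ((x + y) ^ 2) = o (x ^ 2) + (o (x * y) + o (x * y)) + o (y ^ 2) :=
    fun x y => by simp only [← map_add, add_sq, two_mul, add_mul]
  have habc := hsq (a + b + c)
  have hab := hsq (a + b)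
  have hbc := hsq (b + c)
  have hac := hsq (a + c)
  simp only [hadd, add_mul, map_add, add_lie, lie_add, hsq, add_zero,
    zero_add] at habc hab hbc hac
  have h2 : (2 : k) • (⁅o a, o (b * c)⁆ + ⁅o b, o (c * a)⁆ + ⁅o c, o (a * b)⁆) = 0 := by
    rw [mul_comm c a]
    have h := congrArg₂ (· - ·) habc (congrArg₂ (· + ·) hab (congrArg₂ (· + ·) hbc hac))
    simp only [add_zero, sub_zero] at h
    rw [← h]
    module
  exact (smul_eq_zero.mp h2).resolve_left two_ne_zero

end Relations

variable {k : Type*} [Field k] (n : ℕ)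

theorem newtonAction_apply (a : Polynomial k) (x : SymPoly k n) :
    newtonAction k n a x = powerSum k n a * x := by
  have h : newtonAction k n = (LinearMap.mul k (SymPoly k n)) ∘ₗ powerSum k n :=
    (Polynomial.basisMonomials k).ext fun j => by
      rw [newtonAction, Module.Basis.constr_basis, LinearMap.comp_apply,
        Polynomial.coe_basisMonomials]
      simp only [← Polynomial.X_pow_eq_monomial, powerSum_X_pow]
      rfl
  rw [h]
  rfl

variable [CharZero k]

theorem Envelope.lie_of_X_pow_succ (i j : ℕ) :
    ⁅Envelope.of k (Polynomial k) n (Polynomial.X ^ (i + 1)),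
      Envelope.of k (Polynomial k) n (Polynomial.X ^ j)⁆ =
    (i + 1) • ⁅Envelope.of k (Polynomial k) n Polynomial.X,
      Envelope.of k (Polynomial k) n (Polynomial.X ^ (i + j))⁆ := by
  induction i generalizing j with
  | zero => simp
  | succ i ih =>
    have h := Envelope.lie_of_of_mul_cyclic (k := k) n (Polynomial.X ^ (i + 1)) Polynomial.X
      (Polynomial.X ^ j : Polynomial k)
    rw [← pow_succ', ← pow_add, ← pow_succ, ih,
      ← lie_skew (Envelope.of k (Polynomial k) n (Polynomial.X ^ j)), ← sub_eq_add_neg,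
      sub_eq_zero] at h
    rw [← h, show i + (j + 1) = i + 1 + j by lia, show j + (i + 1) = i + 1 + j by lia,
      ← succ_nsmul]

theorem Envelope.of_commute (a b : Polynomial k) :
    Commute (Envelope.of k (Polynomial k) n a) (Envelope.of k (Polynomial k) n b) := by
  set o := Envelope.of k (Polynomial k) n with ho
  have hone : ∀ x, ⁅x, o 1⁆ = 0 := fun x => by
    rw [ho, Envelope.of_one]
    exact sub_eq_zero.mpr (Nat.cast_commute n x).symm
  have hX : ∀ i, ⁅o Polynomial.X, o (Polynomial.X ^ i)⁆ = 0 := fun i => by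
    have h := Envelope.lie_of_X_pow_succ (k := k) n i 0
    rw [pow_zero, hone, add_zero, ← Nat.cast_smul_eq_nsmul k] at h
    exact (smul_eq_zero.mp h.symm).resolve_left (Nat.cast_ne_zero.mpr i.succ_ne_zero)
  have hpow : ∀ i j, ⁅o (Polynomial.X ^ i), o (Polynomial.X ^ j)⁆ = 0 := fun i j => by
    cases i with
    | zero => rw [pow_zero, ← lie_skew, hone, neg_zero]
    | succ i => rw [Envelope.lie_of_X_pow_succ, hX, smul_zero]
  refine sub_eq_zero.mp ?_
  induction a using Polynomial.induction_on' with
  | add p q hp hq => rw [map_add, add_mul, mul_add, add_sub_add_comm, hp, hq, add_zero]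
  | monomial i r =>
    induction b using Polynomial.induction_on' with
    | add p q hp hq => rw [map_add, add_mul, mul_add, add_sub_add_comm, hp, hq, add_zero]
    | monomial j s =>
      rw [← Polynomial.smul_X_eq_monomial, ← Polynomial.smul_X_eq_monomial, map_smul, map_smul]
      exact sub_eq_zero.mpr ((Commute.smul_left (sub_eq_zero.mp (hpow i j)) r).smul_right s)

instance Envelope.instCommRing : CommRing (Envelope k (Polynomial k) n) where
  mul_comm x y := by
    have h : ∀ z : Envelope k (Polynomial k) n, z ∈ Algebra.adjoin k
        (Set.range (Envelope.of k (Polynomial k) n)) := fun z => by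
      rw [Envelope.adjoin_range_of]
      exact Algebra.mem_top
    refine Algebra.commute_of_mem_adjoin_of_forall_mem_commute (h y) ?_
    rintro _ ⟨b, rfl⟩
    refine (Algebra.commute_of_mem_adjoin_of_forall_mem_commute (h x) ?_).symm
    rintro _ ⟨a, rfl⟩
    exact Envelope.of_commute n b a

theorem Envelope.newtonE_of_eq_zero (a : Polynomial k) :
    newtonE k (fun j => Envelope.of k (Polynomial k) n (a ^ j)) (n + 1) = 0 := by
  have hrel := RingQuot.mkAlgHom_rel k (EnvRel.dominant (k := k) (n := n) a)
  rw [map_sum, map_zero] at hrel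
  have h := sum_partition_eq_factorial_smul_newtonE k (n + 1)
    fun j => Envelope.of k (Polynomial k) n (a ^ j)
  have := IsAddTorsionFree.of_isTorsionFree k (Envelope k (Polynomial k) n)
  refine (nsmul_eq_zero_iff_right (n + 1).factorial_ne_zero).mp (h.symm.trans ?_)
  rw [← hrel]
  refine Finset.sum_congr rfl fun σ _ => ?_
  rw [map_zsmul, map_partTensor]
  rfl

/-- The homomorphism from the envelope to the symmetric polynomials. -/
def Envelope.toSymPoly (k : Type*) [Field k] [CharZero k] (n : ℕ) :
    Envelope k (Polynomial k) n →ₐ[k] SymPoly k n :=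
  RingQuot.liftAlgHom k ⟨TensorAlgebra.lift k (powerSum k n), fun x y h => by
    induction h with
    | level => rw [TensorAlgebra.lift_ι_apply, powerSum_one, map_natCast]
    | jordan a => rw [map_mul, map_mul, mul_comm]
    | triple a b c =>
      have hder : innerDer a b c = 0 := by rw [innerDer, mul_left_comm, sub_self]
      rw [hder, map_zero, smul_zero, map_zero, map_sub, map_mul, map_mul, map_sub, map_mul,
        map_mul]
      ring
    | dominant a =>
      simp only [map_sum, map_zero, map_zsmul, map_partTensor, TensorAlgebra.lift_ι_apply]
      rw [sum_partition_eq_factorial_smul_newtonE k (n + 1) fun i => powerSum k n (a ^ i),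
        newtonE_powerSum_eq_zero a n.lt_succ_self, smul_zero]⟩

theorem Envelope.toSymPoly_of (a : Polynomial k) :
    Envelope.toSymPoly k n (Envelope.of k (Polynomial k) n a) = powerSum k n a := by
  simp [Envelope.toSymPoly, Envelope.of]

theorem Envelope.toSymPoly_bijective : Function.Bijective (Envelope.toSymPoly k n) := by
  obtain ⟨θ, hθ⟩ := SymPoly.exists_algHom_of_newtonE (Envelope.of k (Polynomial k) n)
    (Envelope.of_one n) (Envelope.newtonE_of_eq_zero n)
  have hleft : θ.comp (Envelope.toSymPoly k n) = AlgHom.id k _ := by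
    refine AlgHom.ext_of_adjoin_eq_top (Envelope.adjoin_range_of n) ?_
    rintro _ ⟨a, rfl⟩
    rw [AlgHom.comp_apply, Envelope.toSymPoly_of, hθ, AlgHom.id_apply]
  have hright : (Envelope.toSymPoly k n).comp θ = AlgHom.id k _ :=
    SymPoly.algHom_ext fun j _ _ => by
      rw [AlgHom.comp_apply, ← powerSum_X_pow, hθ, Envelope.toSymPoly_of, AlgHom.id_apply]
  exact Function.bijective_iff_has_inverse.mpr
    ⟨θ, DFunLike.congr_fun hleft, DFunLike.congr_fun hright⟩

theorem isFreeOfRank_newtonAction : IsFreeOfRank n 1 (newtonAction k n) := by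
  refine ⟨(Algebra.lmul k (SymPoly k n)).comp (Envelope.toSymPoly k n), fun a => ?_,
    (LinearEquiv.funUnique (Fin 1) k _).trans
      (LinearEquiv.ofBijective (Envelope.toSymPoly k n).toLinearMap
        (Envelope.toSymPoly_bijective n)), fun u w => ?_⟩
  · refine LinearMap.ext fun x => ?_
    rw [newtonAction_apply, AlgHom.comp_apply, Envelope.toSymPoly_of]
    rfl
  · exact map_mul (Envelope.toSymPoly k n) u (w default)

end EnvelopePolynomial

/-! ### Symmetric polynomials of lowering operators -/

section PolyProd

variable {k : Type*} [Field k] {B : Type*} [CommRing B] [Algebra k B]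

/-- The linear map `k[x₁, …, xᵣ] → B` that sends `a₁(x₁) ⋯ aᵣ(xᵣ)` to `φ(a₁) ⋯ φ(aᵣ)`. -/
def polyProd (φ : Polynomial k →ₗ[k] B) (r : ℕ) : MvPolynomial (Fin r) k →ₗ[k] B :=
  (MvPolynomial.basisMonomials (Fin r) k).constr k fun α => ∏ i, φ (Polynomial.X ^ α i)

variable (φ : Polynomial k →ₗ[k] B) (r : ℕ)

theorem polyProd_prod_X_pow (α : Fin r → ℕ) :
    polyProd φ r (∏ i, MvPolynomial.X i ^ α i) = ∏ i, φ (Polynomial.X ^ α i) := by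
  have hα : ∏ i, (MvPolynomial.X i : MvPolynomial (Fin r) k) ^ α i =
      MvPolynomial.basisMonomials (Fin r) k (Finsupp.equivFunOnFinite.symm α) := by
    rw [MvPolynomial.coe_basisMonomials]
    simp only [MvPolynomial.monomial_eq, map_one, one_mul,
      Finsupp.prod_fintype _ _ fun _ => pow_zero _, Finsupp.equivFunOnFinite_symm_apply_apply]
  rw [hα, polyProd, Module.Basis.constr_basis]
  rfl

theorem polyProd_prod (a : Fin r → Polynomial k) :
    polyProd φ r (∏ i, Polynomial.aeval (MvPolynomial.X i) (a i)) = ∏ i, φ (a i) := by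
  have h : (polyProd φ r).compMultilinearMap
      ((MultilinearMap.mkPiAlgebra k (Fin r) (MvPolynomial (Fin r) k)).compLinearMap
        fun i => (Polynomial.aeval (MvPolynomial.X i)).toLinearMap) =
      (MultilinearMap.mkPiAlgebra k (Fin r) B).compLinearMap fun _ => φ := by
    refine Module.Basis.ext_multilinear (fun _ => Polynomial.basisMonomials k) fun α => ?_
    simp only [LinearMap.compMultilinearMap_apply, MultilinearMap.compLinearMap_apply,
      MultilinearMap.mkPiAlgebra_apply, Polynomial.coe_basisMonomials,
      ← Polynomial.X_pow_eq_monomial, AlgHom.toLinearMap_apply, map_pow, Polynomial.aeval_X,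
      polyProd_prod_X_pow]
  exact congrArg (fun f => f a) h

theorem polyProd_powerProd (a : Polynomial k) : polyProd φ r (powerProd k r a) = φ a ^ r := by
  rw [coe_powerProd, polyProd_prod φ r fun _ => a, Finset.prod_const, Finset.card_univ,
    Fintype.card_fin]

theorem prod_apply_update {ι α M : Type*} [Fintype ι] [DecidableEq ι] [CommMonoid M]
    (g : ι → α → M) (a b : α) (i : ι) :
    ∏ j, g j (Function.update (fun _ => a) i b j) = g i b * ∏ j ∈ Finset.univ.erase i, g j a := by
  rw [← Finset.mul_prod_erase _ _ (Finset.mem_univ i), Function.update_self]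
  exact congrArg _ (Finset.prod_congr rfl fun j hj => by
    rw [Function.update_of_ne (Finset.ne_of_mem_erase hj)])

theorem coe_powerProd_mul_powerSum (a c : Polynomial k) :
    ((powerProd k r a * powerSum k r c : SymPoly k r) : MvPolynomial (Fin r) k) =
      ∑ i, ∏ j, Polynomial.aeval (MvPolynomial.X j)
        (Function.update (fun _ => a) i (c * a) j) := by
  rw [MulMemClass.coe_mul, coe_powerProd, coe_powerSum, Finset.mul_sum]
  refine Finset.sum_congr rfl fun i _ => ?_
  rw [prod_apply_update fun j p => Polynomial.aeval (MvPolynomial.X j) p, map_mul, mul_assoc,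
    Finset.mul_prod_erase _ (fun j => Polynomial.aeval (MvPolynomial.X j) a) (Finset.mem_univ i),
    mul_comm]

theorem polyProd_powerProd_mul_powerSum (a c : Polynomial k) :
    polyProd φ r ((powerProd k r a * powerSum k r c : SymPoly k r) : MvPolynomial (Fin r) k) =
      r • (φ (c * a) * φ a ^ (r - 1)) := by
  rw [coe_powerProd_mul_powerSum, map_sum]
  simp only [polyProd_prod, prod_apply_update fun _ p => φ p, Finset.prod_const,
    Finset.card_erase_of_mem (Finset.mem_univ _), Finset.sum_const, Finset.card_univ,
    Fintype.card_fin]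

end PolyProd

section Current

variable (k : Type*) [Field k] {A : Type*} [CommRing A] [Algebra k A]

/-- `f(a)`, where `f = !![0, 0; 1, 0]`. -/
def fElt (a : A) : Current k A :=
  a ⊗ₜ[k] LieAlgebra.SpecialLinear.single 1 0 (by decide) (1 : k)

theorem lie_eElt_fElt (a b : A) : ⁅eElt k a, fElt k b⁆ = hElt k (a * b) := by
  rw [eElt, fElt, hElt, LieAlgebra.ExtendScalars.bracket_tmul]
  congr 1
  refine Subtype.ext (Matrix.ext fun i j => ?_)
  fin_cases i <;> fin_cases j <;> simp [Ring.lie_def]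

theorem lie_hElt_fElt (a b : A) : ⁅hElt k a, fElt k b⁆ = -(2 • fElt k (a * b)) := by
  rw [fElt, hElt, fElt, LieAlgebra.ExtendScalars.bracket_tmul, ← TensorProduct.tmul_smul,
    ← TensorProduct.tmul_neg]
  congr 1
  refine Subtype.ext (Matrix.ext fun i j => ?_)
  fin_cases i <;> fin_cases j <;> norm_num [Ring.lie_def]

theorem lie_fElt_fElt (a b : A) : ⁅fElt k a, fElt k b⁆ = 0 := by
  rw [fElt, fElt, LieAlgebra.ExtendScalars.bracket_tmul, lie_self, TensorProduct.tmul_zero]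

variable {k}

theorem sl_eq_add_add (x : LieAlgebra.SpecialLinear.sl (Fin 2) k) :
    x = x.1 0 1 • LieAlgebra.SpecialLinear.single 0 1 (by decide) (1 : k) +
      x.1 0 0 • LieAlgebra.SpecialLinear.singleSubSingle 0 1 (1 : k) +
      x.1 1 0 • LieAlgebra.SpecialLinear.single 1 0 (by decide) (1 : k) := by
  have htrace : x.1 0 0 + x.1 1 1 = 0 := by
    rw [← Matrix.trace_fin_two]
    exact x.2
  refine Subtype.ext (Matrix.ext fun i j => ?_)
  fin_cases i <;> fin_cases j <;> simp [eq_neg_of_add_eq_zero_right htrace]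

theorem Current.submodule_eq_top {N : Submodule k (Current k A)}
    (he : ∀ a, eElt k a ∈ N) (hh : ∀ a, hElt k a ∈ N) (hf : ∀ a, fElt k a ∈ N) : N = ⊤ := by
  refine eq_top_iff.mpr fun x _ => ?_
  induction x using TensorProduct.induction_on with
  | zero => exact zero_mem _
  | add x y hx hy => exact add_mem (hx trivial) (hy trivial)
  | tmul a x =>
    rw [sl_eq_add_add x, TensorProduct.tmul_add, TensorProduct.tmul_add, TensorProduct.tmul_smul,
      TensorProduct.tmul_smul, TensorProduct.tmul_smul]
    exact add_mem (add_mem (N.smul_mem _ (he a)) (N.smul_mem _ (hh a))) (N.smul_mem _ (hf a))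

end Current

section Lowering

variable (k : Type*) [Field k]
  (W : Type*) [AddCommGroup W] [Module k W] [LieRingModule (Current k (Polynomial k)) W]
  [LieModule k (Current k (Polynomial k)) W]

/-- The operators `f(a)` on an `sl₂[t]`-module. -/
def fOp : Polynomial k →ₗ[k] Module.End k W where
  toFun a := LieModule.toEnd k (Current k (Polynomial k)) W (fElt k a)
  map_add' a b := by rw [fElt, TensorProduct.add_tmul, map_add]; rfl
  map_smul' c a := by rw [fElt, ← TensorProduct.smul_tmul', map_smul]; rfl

/-- The algebra generated by the commuting operators `f(a)`. -/
abbrev LowerAlgebra : Subalgebra k (Module.End k W) := Algebra.adjoin k (Set.range (fOp k W))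

instance : IsMulCommutative (LowerAlgebra k W) :=
  Algebra.isMulCommutative_adjoin k (by
    rintro _ ⟨a, rfl⟩ _ ⟨b, rfl⟩
    refine LinearMap.ext fun x => ?_
    change ⁅fElt k a, ⁅fElt k b, x⁆⁆ = ⁅fElt k b, ⁅fElt k a, x⁆⁆
    rw [leibniz_lie, lie_fElt_fElt, zero_lie, zero_add])

instance : CommRing (LowerAlgebra k W) :=
  { (inferInstance : Ring (LowerAlgebra k W)) with mul_comm := mul_comm' }

/-- The operators `f(a)`, as elements of the commutative algebra that they generate. -/
def lowerOp : Polynomial k →ₗ[k] LowerAlgebra k W :=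
  (fOp k W).codRestrict (Subalgebra.toSubmodule (LowerAlgebra k W))
    fun a => Algebra.subset_adjoin ⟨a, rfl⟩

variable {k W}

theorem lowerOp_smul (a : Polynomial k) (x : W) : lowerOp k W a • x = ⁅fElt k a, x⁆ := rfl

theorem smul_nsmul_mul_pow_sub_one_smul {R V : Type*} [CommSemiring R] [AddCommMonoid V]
    [Module R V] (x y : R) (r : ℕ) (v : V) :
    y • r • (x * y ^ (r - 1)) • v = r • (x * y ^ r) • v := by
  cases r with
  | zero => rw [zero_smul, smul_zero]
  | succ r => rw [Nat.add_sub_cancel, smul_comm, ← mul_smul, mul_left_comm, ← pow_succ']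

theorem lie_hElt_lowerOp_pow_smul (c a : Polynomial k) (r : ℕ) (x : W) :
    ⁅hElt k c, lowerOp k W a ^ r • x⁆ = lowerOp k W a ^ r • ⁅hElt k c, x⁆ -
      2 • r • (lowerOp k W (c * a) * lowerOp k W a ^ (r - 1)) • x := by
  induction r with
  | zero => simp
  | succ r ih =>
    rw [pow_succ', mul_smul, lowerOp_smul, leibniz_lie, lie_hElt_fElt, neg_lie, nsmul_lie,
      ← lowerOp_smul, ← lowerOp_smul, ih, smul_sub, smul_comm _ 2,
      smul_nsmul_mul_pow_sub_one_smul, Nat.add_sub_cancel]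
    module

/-- A linear map from the symmetric polynomials to an `sl₂[t]`-module that is annihilated by the
`e(a)` and on which `h(a)` acts through multiplication by the power sums `a(x₁) + ⋯ + a(xₙ)`. -/
structure IsHighestWeight (n : ℕ) (w : SymPoly k n →ₗ[k] W) : Prop where
  lie_e : ∀ (a : Polynomial k) m, ⁅eElt k a, w m⁆ = 0
  lie_h : ∀ (a : Polynomial k) m, ⁅hElt k a, w m⁆ = w (powerSum k n a * m)

theorem IsHighestWeight.lie_eElt_lowerOp_pow_smul {n : ℕ} {w : SymPoly k n →ₗ[k] W}
    (hw : IsHighestWeight n w) (b a : Polynomial k) (r : ℕ) (m : SymPoly k n) :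
    ⁅eElt k b, lowerOp k W a ^ (r + 1) • w m⁆ =
      (r + 1) • (lowerOp k W a ^ r • w (powerSum k n (b * a) * m) -
        r • (lowerOp k W (b * a * a) * lowerOp k W a ^ (r - 1)) • w m) := by
  induction r with
  | zero =>
    rw [zero_add, pow_one, lowerOp_smul, leibniz_lie, lie_eElt_fElt, hw.lie_e, lie_zero, add_zero,
      hw.lie_h, pow_zero, one_smul, one_smul, zero_smul, sub_zero]
  | succ r ih =>
    rw [pow_succ', mul_smul, lowerOp_smul, leibniz_lie, lie_eElt_fElt, ← lowerOp_smul, ih,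
      lie_hElt_lowerOp_pow_smul, hw.lie_h, smul_comm (lowerOp k W a) (r + 1), smul_sub,
      smul_nsmul_mul_pow_sub_one_smul, ← mul_smul (lowerOp k W a), ← pow_succ', Nat.add_sub_cancel]
    module

end Lowering

/-! ### Polynomials symmetric in two sets of variables -/

/-- Polynomials that are symmetric in two separate sets of `r` and `n` variables. This is a
definition, not an abbreviation, to keep instance search away from the tensor product. -/
def BiSym (k : Type*) [Field k] (r n : ℕ) : Type _ := SymPoly k r ⊗[k] SymPoly k n

namespace BiSym

variable {k : Type*} [Field k] {r n : ℕ}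

instance : CommRing (BiSym k r n) := inferInstanceAs (CommRing (SymPoly k r ⊗[k] SymPoly k n))

instance : Algebra k (BiSym k r n) := inferInstanceAs (Algebra k (SymPoly k r ⊗[k] SymPoly k n))

/-- Symmetric polynomials in the first set of variables. -/
def inl : SymPoly k r →ₐ[k] BiSym k r n :=
  (Algebra.TensorProduct.includeLeft : SymPoly k r →ₐ[k] SymPoly k r ⊗[k] SymPoly k n)

/-- Symmetric polynomials in the second set of variables. -/
def inr : SymPoly k n →ₐ[k] BiSym k r n :=
  (Algebra.TensorProduct.includeRight : SymPoly k n →ₐ[k] SymPoly k r ⊗[k] SymPoly k n)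

/-- The linear map out of `BiSym k r n` given by a bilinear map. -/
def liftLinear {E : Type*} [AddCommGroup E] [Module k E]
    (f : SymPoly k r →ₗ[k] SymPoly k n →ₗ[k] E) : BiSym k r n →ₗ[k] E :=
  (TensorProduct.lift f : SymPoly k r ⊗[k] SymPoly k n →ₗ[k] E)

/-- The algebra homomorphism out of `BiSym k r n` given by its restrictions to both factors. -/
def lift {C : Type*} [CommRing C] [Algebra k C] (f : SymPoly k r →ₐ[k] C)
    (g : SymPoly k n →ₐ[k] C) : BiSym k r n →ₐ[k] C :=
  (Algebra.TensorProduct.productMap f g : SymPoly k r ⊗[k] SymPoly k n →ₐ[k] C)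

theorem inl_mul_inr (y : SymPoly k r) (m : SymPoly k n) :
    (inl y * inr m : BiSym k r n) = (y ⊗ₜ[k] m : SymPoly k r ⊗[k] SymPoly k n) :=
  (Algebra.TensorProduct.tmul_mul_tmul _ _ _ _).trans (by rw [mul_one, one_mul])

section LinearMap

variable {E : Type*} [AddCommGroup E] [Module k E]

theorem liftLinear_inl_mul_inr (f : SymPoly k r →ₗ[k] SymPoly k n →ₗ[k] E) (y : SymPoly k r)
    (m : SymPoly k n) : liftLinear f (inl y * inr m) = f y m := by
  rw [inl_mul_inr]
  rfl

theorem linearMap_ext {f g : BiSym k r n →ₗ[k] E}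
    (h : ∀ y m, f (inl y * inr m) = g (inl y * inr m)) : f = g :=
  TensorProduct.ext' (R := k) (M := SymPoly k r) (N := SymPoly k n) fun y m => by
    have hym := h y m
    rwa [inl_mul_inr] at hym

theorem linearMap_ext_powerProd [Infinite k] {f g : BiSym k r n →ₗ[k] E}
    (h : ∀ a m, f (inl (powerProd k r a) * inr m) = g (inl (powerProd k r a) * inr m)) : f = g :=
  linearMap_ext fun y m => by
    have hm : f ∘ₗ LinearMap.mulRight k (inr m) ∘ₗ inl.toLinearMap =
        g ∘ₗ LinearMap.mulRight k (inr m) ∘ₗ inl.toLinearMap :=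
      LinearMap.ext_on_range (span_powerProd r) fun a => h a m
    exact LinearMap.congr_fun hm y

end LinearMap

section AlgHom

variable {C : Type*} [CommRing C] [Algebra k C]

theorem lift_inl (f : SymPoly k r →ₐ[k] C) (g : SymPoly k n →ₐ[k] C) (y : SymPoly k r) :
    lift f g (inl y) = f y :=
  Algebra.TensorProduct.productMap_left_apply f g y

theorem lift_inr (f : SymPoly k r →ₐ[k] C) (g : SymPoly k n →ₐ[k] C) (m : SymPoly k n) :
    lift f g (inr m) = g m :=
  Algebra.TensorProduct.productMap_right_apply f g m

theorem subalgebra_eq_top_of_newton_mem [CharZero k] {S : Subalgebra k (BiSym k r n)}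
    (hl : ∀ j, inl (newton k r j) ∈ S) (hr : ∀ j, inr (newton k n j) ∈ S) : S = ⊤ := by
  have hl' : S.comap inl = ⊤ := SymPoly.subalgebra_eq_top_of_newton_mem fun j _ _ => hl j
  have hr' : S.comap inr = ⊤ := SymPoly.subalgebra_eq_top_of_newton_mem fun j _ _ => hr j
  have hq : (Subalgebra.toSubmodule S).mkQ = 0 := linearMap_ext fun y m =>
    (Submodule.Quotient.mk_eq_zero _).mpr
      (S.mul_mem (Algebra.eq_top_iff.mp hl' y) (Algebra.eq_top_iff.mp hr' m))
  exact Algebra.eq_top_iff.mpr fun x =>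
    (Submodule.Quotient.mk_eq_zero _).mp (LinearMap.congr_fun hq x)

theorem algHom_ext_of_newton [CharZero k] {f g : BiSym k r n →ₐ[k] C}
    (hl : ∀ j, f (inl (newton k r j)) = g (inl (newton k r j)))
    (hr : ∀ j, f (inr (newton k n j)) = g (inr (newton k n j))) : f = g :=
  AlgHom.equalizer_eq_top.mp (subalgebra_eq_top_of_newton_mem hl hr)

end AlgHom

end BiSym

section LowerMap

variable {k : Type*} [Field k] {r n : ℕ}

/-- The element `∑ⱼ a(yⱼ) - ∑ᵢ a(xᵢ)`, with `x₁, …, xᵣ` and `y₁, …, yₙ` the two sets of variables.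
It is the factor that appears when `e` is moved past `r + 1` lowering operators. -/
def shiftedSum (k : Type*) [Field k] (n r : ℕ) : Polynomial k →ₗ[k] BiSym k r n :=
  BiSym.inr.toLinearMap ∘ₗ powerSum k n - BiSym.inl.toLinearMap ∘ₗ powerSum k r

theorem shiftedSum_apply (n r : ℕ) (a : Polynomial k) :
    shiftedSum k n r a = BiSym.inr (powerSum k n a) - BiSym.inl (powerSum k r a) := rfl

variable {W : Type*} [AddCommGroup W] [Module k W] [LieRingModule (Current k (Polynomial k)) W]
  [LieModule k (Current k (Polynomial k)) W]

/-- The linear map `y ⊗ m ↦ y(f) w(m)`, where `a₁(x₁) ⋯ aᵣ(xᵣ)` at `f` is `f(a₁) ⋯ f(aᵣ)`. -/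
def lowerMap (w : SymPoly k n →ₗ[k] W) (r : ℕ) : BiSym k r n →ₗ[k] W :=
  BiSym.liftLinear (LinearMap.lcomp k W w ∘ₗ (LowerAlgebra k W).val.toLinearMap ∘ₗ
    polyProd (lowerOp k W) r ∘ₗ (MvPolynomial.symmetricSubalgebra (Fin r) k).val.toLinearMap)

theorem lowerMap_inl_mul_inr (w : SymPoly k n →ₗ[k] W) (r : ℕ) (y : SymPoly k r)
    (m : SymPoly k n) :
    lowerMap w r (BiSym.inl y * BiSym.inr m) = polyProd (lowerOp k W) r y • w m := by
  rw [lowerMap, BiSym.liftLinear_inl_mul_inr]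
  rfl

theorem lowerMap_powerProd (w : SymPoly k n →ₗ[k] W) (r : ℕ) (a : Polynomial k)
    (m : SymPoly k n) : lowerMap w r (BiSym.inl (powerProd k r a) * BiSym.inr m) =
      lowerOp k W a ^ r • w m := by
  rw [lowerMap_inl_mul_inr, polyProd_powerProd]

theorem IsHighestWeight.lie_eElt_lowerMap_powerProd {w : SymPoly k n →ₗ[k] W}
    (hw : IsHighestWeight n w) (b a : Polynomial k) (r : ℕ) (m : SymPoly k n) :
    ⁅eElt k b, lowerMap w (r + 1) (BiSym.inl (powerProd k (r + 1) a) * BiSym.inr m)⁆ =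
      (r + 1) • lowerMap w r
        (BiSym.inl (powerProd k r a) * BiSym.inr m * shiftedSum k n r (b * a)) := by
  have h : (BiSym.inl (powerProd k r a) * BiSym.inr m * shiftedSum k n r (b * a) : BiSym k r n) =
      BiSym.inl (powerProd k r a) * BiSym.inr (powerSum k n (b * a) * m) -
        BiSym.inl (powerProd k r a * powerSum k r (b * a)) * BiSym.inr m := by
    rw [shiftedSum_apply, map_mul BiSym.inr, map_mul BiSym.inl]
    ring
  rw [h, map_sub, lowerMap_powerProd, hw.lie_eElt_lowerOp_pow_smul, lowerMap_powerProd,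
    lowerMap_inl_mul_inr, polyProd_powerProd_mul_powerSum, smul_assoc]

end LowerMap

/-! ### Splitting off one lowering operator -/

section SplitVar

variable (k : Type*) [Field k]

/-- The inclusion of the polynomials in a first variable, with coefficients symmetric in `r` further
variables, into all polynomials in `r + 1` variables. -/
def joinVar (r : ℕ) : Polynomial (SymPoly k r) →ₐ[k] MvPolynomial (Fin (r + 1)) k :=
  ((MvPolynomial.finSuccEquiv k r).symm : _ →ₐ[k] _).comp
    (Polynomial.mapAlgHom (MvPolynomial.symmetricSubalgebra (Fin r) k).val)

theorem joinVar_injective (r : ℕ) : Function.Injective (joinVar k r) :=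
  (MvPolynomial.finSuccEquiv k r).symm.injective.comp
    (Polynomial.map_injective _ Subtype.val_injective)

theorem joinVar_C (r : ℕ) (y : SymPoly k r) :
    joinVar k r (Polynomial.C y) = MvPolynomial.rename Fin.succ (y : MvPolynomial (Fin r) k) := by
  have h : (MvPolynomial.finSuccEquiv k r).toAlgHom.comp (MvPolynomial.rename Fin.succ) =
      Polynomial.CAlgHom :=
    MvPolynomial.algHom_ext fun i => by simp [MvPolynomial.finSuccEquiv_X_succ]
  change (MvPolynomial.finSuccEquiv k r).symm (Polynomial.map _ (Polynomial.C y)) = _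
  rw [AlgEquiv.symm_apply_eq, Polynomial.map_C]
  exact (DFunLike.congr_fun h (y : MvPolynomial (Fin r) k)).symm

theorem joinVar_X (r : ℕ) : joinVar k r Polynomial.X = MvPolynomial.X 0 := by
  change (MvPolynomial.finSuccEquiv k r).symm (Polynomial.map _ Polynomial.X) = _
  rw [AlgEquiv.symm_apply_eq, Polynomial.map_X, MvPolynomial.finSuccEquiv_X_zero]

theorem joinVar_aeval_X (r : ℕ) (a : Polynomial k) :
    joinVar k r (Polynomial.aeval Polynomial.X a) = Polynomial.aeval (MvPolynomial.X 0) a := by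
  rw [← Polynomial.aeval_algHom_apply, joinVar_X]

variable [CharZero k]

theorem exists_splitVar (r : ℕ) :
    ∃ δ : SymPoly k (r + 1) →ₐ[k] Polynomial (SymPoly k r), ∀ y, joinVar k r (δ y) = y := by
  obtain ⟨δ, hδ⟩ := SymPoly.exists_algHom (k := k) (m := r + 1)
    fun j => Polynomial.C (newton k r j) + Polynomial.X ^ j
  have h : (joinVar k r).comp δ = (MvPolynomial.symmetricSubalgebra (Fin (r + 1)) k).val :=
    SymPoly.algHom_ext fun j h1 h2 => by
      rw [AlgHom.comp_apply, hδ j h1 h2, map_add, map_pow, joinVar_C, joinVar_X]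
      simp [coe_newton, MvPolynomial.psum, Fin.sum_univ_succ, add_comm]
  exact ⟨δ, DFunLike.congr_fun h⟩

/-- A symmetric polynomial in `r + 1` variables, as a polynomial in the first variable whose
coefficients are symmetric in the other variables. -/
def splitVar (r : ℕ) : SymPoly k (r + 1) →ₐ[k] Polynomial (SymPoly k r) :=
  (exists_splitVar k r).choose

theorem joinVar_splitVar (r : ℕ) (y : SymPoly k (r + 1)) : joinVar k r (splitVar k r y) = y :=
  (exists_splitVar k r).choose_spec y

theorem splitVar_powerProd (r : ℕ) (a : Polynomial k) : splitVar k r (powerProd k (r + 1) a) =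
    Polynomial.C (powerProd k r a) * Polynomial.aeval Polynomial.X a := by
  refine joinVar_injective k r ?_
  rw [joinVar_splitVar, map_mul, joinVar_C, joinVar_aeval_X, coe_powerProd, coe_powerProd,
    map_prod, Fin.prod_univ_succ, mul_comm]
  simp only [← Polynomial.aeval_algHom_apply, MvPolynomial.rename_X]

theorem splitVar_powerSum (r : ℕ) (a : Polynomial k) : splitVar k r (powerSum k (r + 1) a) =
    Polynomial.C (powerSum k r a) + Polynomial.aeval Polynomial.X a := by
  refine joinVar_injective k r ?_
  rw [joinVar_splitVar, map_add, joinVar_C, joinVar_aeval_X, coe_powerSum, coe_powerSum,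
    map_sum, Fin.sum_univ_succ, add_comm (_ : MvPolynomial (Fin (r + 1)) k)]
  simp only [← Polynomial.aeval_algHom_apply, MvPolynomial.rename_X]

end SplitVar

section Split

variable (k : Type*) [Field k] [CharZero k] (n r : ℕ)

/-- The expansion along the first variable of a polynomial symmetric in two sets of `r + 1` and `n`
variables. -/
def BiSym.split : BiSym k (r + 1) n →ₐ[k] Polynomial (BiSym k r n) :=
  BiSym.lift ((Polynomial.mapAlgHom BiSym.inl).comp (splitVar k r))
    (Polynomial.CAlgHom.comp BiSym.inr)

theorem BiSym.split_inr (m : SymPoly k n) :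
    BiSym.split k n r (BiSym.inr m) = Polynomial.C (BiSym.inr m) := by
  rw [BiSym.split, BiSym.lift_inr]
  rfl

theorem BiSym.split_inl_powerProd (a : Polynomial k) :
    BiSym.split k n r (BiSym.inl (powerProd k (r + 1) a)) =
      Polynomial.C (BiSym.inl (powerProd k r a)) * Polynomial.aeval Polynomial.X a := by
  rw [BiSym.split, BiSym.lift_inl, AlgHom.comp_apply, splitVar_powerProd, map_mul,
    ← Polynomial.aeval_algHom_apply]
  simp

theorem BiSym.split_inl_powerSum (a : Polynomial k) :
    BiSym.split k n r (BiSym.inl (powerSum k (r + 1) a)) =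
      Polynomial.C (BiSym.inl (powerSum k r a)) + Polynomial.aeval Polynomial.X a := by
  rw [BiSym.split, BiSym.lift_inl, AlgHom.comp_apply, splitVar_powerSum, map_add,
    ← Polynomial.aeval_algHom_apply]
  simp

theorem BiSym.split_shiftedSum (a : Polynomial k) :
    BiSym.split k n r (shiftedSum k n (r + 1) a) =
      Polynomial.C (shiftedSum k n r a) - Polynomial.aeval Polynomial.X a := by
  rw [shiftedSum_apply, shiftedSum_apply, map_sub, BiSym.split_inr, BiSym.split_inl_powerSum,
    map_sub]
  ring

theorem BiSym.productMap_split_surjective : Function.Surjective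
    (Algebra.TensorProduct.productMap (BiSym.split k n r)
      (Polynomial.aeval (Polynomial.X : Polynomial (BiSym k r n)))) := by
  set φ := Algebra.TensorProduct.productMap (BiSym.split k n r)
    (Polynomial.aeval (Polynomial.X : Polynomial (BiSym k r n)))
  have hsplit (x : BiSym k (r + 1) n) : BiSym.split k n r x ∈ φ.range :=
    ⟨x ⊗ₜ 1, Algebra.TensorProduct.productMap_left_apply _ _ x⟩
  have haeval (a : Polynomial k) : Polynomial.aeval Polynomial.X a ∈ φ.range :=
    ⟨1 ⊗ₜ a, Algebra.TensorProduct.productMap_right_apply _ _ a⟩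
  have hC : φ.range.comap Polynomial.CAlgHom = ⊤ := by
    refine BiSym.subalgebra_eq_top_of_newton_mem (fun j => ?_) fun j => ?_
    · have h := sub_mem (hsplit (BiSym.inl (powerSum k (r + 1) (Polynomial.X ^ j))))
        (haeval (Polynomial.X ^ j))
      rwa [BiSym.split_inl_powerSum, add_sub_cancel_right, powerSum_X_pow] at h
    · have h := hsplit (BiSym.inr (newton k n j))
      rwa [BiSym.split_inr] at h
  have hC' (z : BiSym k r n) : Polynomial.C z ∈ φ.range := Algebra.eq_top_iff.mp hC z
  have hX : Polynomial.X ∈ φ.range := by simpa only [Polynomial.aeval_X] using haeval Polynomial.X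
  refine fun p => (?_ : p ∈ φ.range)
  induction p using Polynomial.induction_on' with
  | add p q hp hq => exact add_mem hp hq
  | monomial i z =>
    rw [← Polynomial.C_mul_X_pow_eq_monomial]
    exact mul_mem (hC' z) (pow_mem hX i)

end Split

section Contract

variable (k : Type*) [Field k] (n r : ℕ)

/-- The contraction of the variable against `shiftedSum`: the linear map given by
`a(X) ↦ shiftedSum k n r a`. -/
def contract : Polynomial (BiSym k r n) →ₗ[BiSym k r n] BiSym k r n :=
  (Polynomial.basisMonomials (BiSym k r n)).constr (BiSym k r n)
    fun j => shiftedSum k n r (Polynomial.X ^ j)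

theorem contract_aeval_X (a : Polynomial k) :
    contract k n r (Polynomial.aeval Polynomial.X a) = shiftedSum k n r a := by
  have h : (contract k n r).restrictScalars k ∘ₗ (Polynomial.aeval Polynomial.X).toLinearMap =
      shiftedSum k n r := (Polynomial.basisMonomials k).ext fun j => by
    have hj : (Polynomial.X : Polynomial (BiSym k r n)) ^ j =
      Polynomial.basisMonomials (BiSym k r n) j := Polynomial.X_pow_eq_monomial j
    rw [LinearMap.comp_apply, Polynomial.coe_basisMonomials]
    simp only [← Polynomial.X_pow_eq_monomial, AlgHom.toLinearMap_apply, map_pow,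
      Polynomial.aeval_X, LinearMap.restrictScalars_apply]
    rw [hj, contract, Module.Basis.constr_basis]
  exact LinearMap.congr_fun h a

variable {k n r}

theorem contract_C_mul (x : BiSym k r n) (q : Polynomial (BiSym k r n)) :
    contract k n r (Polynomial.C x * q) = x * contract k n r q := by
  rw [← Polynomial.smul_eq_C_mul, map_smul, smul_eq_mul]

theorem contract_C_mul_aeval_X (x : BiSym k r n) (a : Polynomial k) :
    contract k n r (Polynomial.C x * Polynomial.aeval Polynomial.X a) =
      x * shiftedSum k n r a := by
  rw [contract_C_mul, contract_aeval_X]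

/-- Splitting off a variable shifts the power sums by its powers, so that the contraction becomes
the right hand side of Newton's identity. -/
theorem contract_split_newtonE [CharZero k] (c : Polynomial k) (s : ℕ) :
    contract k n r (BiSym.split k n r (newtonE k (fun j => shiftedSum k n (r + 1) (c ^ j)) s) *
      Polynomial.aeval Polynomial.X c) =
        ((s + 1 : ℕ) : k) • newtonE k (fun j => shiftedSum k n r (c ^ j)) (s + 1) := by
  have hC (i : ℕ) : newtonE k (fun j => Polynomial.C (shiftedSum k n r (c ^ j))) i =
      Polynomial.C (newtonE k (fun j => shiftedSum k n r (c ^ j)) i) :=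
    (map_newtonE k _ (Polynomial.CAlgHom (R := k) (A := BiSym k r n)) i).symm
  have hterm (i : ℕ) (z : BiSym k r n) :
      (-Polynomial.aeval (Polynomial.X : Polynomial (BiSym k r n)) c) ^ i * Polynomial.C z *
        Polynomial.aeval Polynomial.X c =
      Polynomial.C ((-1) ^ i * z) * Polynomial.aeval Polynomial.X (c ^ (i + 1)) := by
    rw [map_mul, map_pow, map_pow, map_neg, map_one, neg_pow]
    ring
  rw [map_newtonE, newtonE_succ, smul_inv_smul₀ (Nat.cast_ne_zero.mpr s.succ_ne_zero)]
  simp only [BiSym.split_shiftedSum, map_pow (Polynomial.aeval _)]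
  rw [newtonE_sub_pow, Finset.sum_mul, map_sum]
  simp only [hC, hterm, contract_C_mul_aeval_X]
  exact Finset.sum_congr rfl fun i _ => mul_right_comm _ _ _

end Contract

section LowerIdeal

variable {k : Type*} [Field k] {n : ℕ} {W : Type*} [AddCommGroup W] [Module k W]
  [LieRingModule (Current k (Polynomial k)) W] [LieModule k (Current k (Polynomial k)) W]

/-- The largest ideal in the kernel of `lowerMap w r`. -/
def lowerIdeal (w : SymPoly k n →ₗ[k] W) (r : ℕ) : Ideal (BiSym k r n) where
  carrier := {x | ∀ y, lowerMap w r (y * x) = 0}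
  zero_mem' y := by rw [mul_zero, map_zero]
  add_mem' hx hy y := by rw [mul_add, map_add, hx, hy, add_zero]
  smul_mem' c x hx y := by rw [smul_eq_mul, ← mul_assoc, hx]

variable {w : SymPoly k n →ₗ[k] W} {r s : ℕ}

theorem lowerMap_eq_zero_of_mem {x : BiSym k r n} (hx : x ∈ lowerIdeal w r) :
    lowerMap w r x = 0 := by
  rw [← one_mul x, hx]

variable [CharZero k]

theorem IsHighestWeight.lie_eElt_lowerMap (hw : IsHighestWeight n w) (b : Polynomial k)
    (x : BiSym k (r + 1) n) : ⁅eElt k b, lowerMap w (r + 1) x⁆ =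
      (r + 1) • lowerMap w r
        (contract k n r (BiSym.split k n r x * Polynomial.aeval Polynomial.X b)) := by
  have h : LieModule.toEnd k (Current k (Polynomial k)) W (eElt k b) ∘ₗ lowerMap w (r + 1) =
      (r + 1) • (lowerMap w r ∘ₗ (contract k n r).restrictScalars k ∘ₗ
        LinearMap.mulRight k (Polynomial.aeval Polynomial.X b) ∘ₗ
          (BiSym.split k n r).toLinearMap) := by
    refine BiSym.linearMap_ext_powerProd fun a m => ?_
    refine (hw.lie_eElt_lowerMap_powerProd b a r m).trans ?_
    simp only [LinearMap.smul_apply, LinearMap.comp_apply, LinearMap.restrictScalars_apply,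
      LinearMap.mulRight_apply, AlgHom.toLinearMap_apply]
    rw [map_mul (BiSym.split k n r), BiSym.split_inl_powerProd, BiSym.split_inr,
      mul_right_comm (Polynomial.C _), ← map_mul, mul_assoc (Polynomial.C _),
      ← map_mul (Polynomial.aeval _), contract_C_mul_aeval_X, mul_comm b]
  exact LinearMap.congr_fun h x

theorem IsHighestWeight.lowerMap_contract_eq_zero (hw : IsHighestWeight n w)
    {x : BiSym k (r + 1) n} (hx : x ∈ lowerIdeal w (r + 1)) (q : Polynomial (BiSym k r n)) :
    lowerMap w r (contract k n r (BiSym.split k n r x * q)) = 0 := by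
  obtain ⟨z, rfl⟩ := BiSym.productMap_split_surjective k n r q
  induction z using TensorProduct.induction_on with
  | zero => simp only [map_zero, mul_zero]
  | add z z' hz hz' => rw [map_add, mul_add, map_add, map_add, hz, hz', add_zero]
  | tmul y b =>
    have h := hw.lie_eElt_lowerMap b (x * y)
    rw [lowerMap_eq_zero_of_mem (Ideal.mul_mem_right y _ hx), lie_zero,
      ← Nat.cast_smul_eq_nsmul k, map_mul (BiSym.split k n r), mul_assoc] at h
    exact (smul_eq_zero.mp h.symm).resolve_left (Nat.cast_ne_zero.mpr r.succ_ne_zero)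

theorem IsHighestWeight.contract_mem_lowerIdeal (hw : IsHighestWeight n w)
    {x : BiSym k (r + 1) n} (hx : x ∈ lowerIdeal w (r + 1)) (q : Polynomial (BiSym k r n)) :
    contract k n r (BiSym.split k n r x * q) ∈ lowerIdeal w r := fun y => by
  rw [← contract_C_mul, mul_left_comm, hw.lowerMap_contract_eq_zero hx]

theorem IsHighestWeight.newtonE_mem_lowerIdeal (hw : IsHighestWeight n w)
    (h0 : lowerMap w (r + s) = 0) (c : Polynomial k) :
    newtonE k (fun j => shiftedSum k n r (c ^ j)) s ∈ lowerIdeal w r := by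
  induction s generalizing r with
  | zero => exact fun y => LinearMap.congr_fun h0 _
  | succ s ih =>
    have h := hw.contract_mem_lowerIdeal (ih (r := r + 1) (by rwa [add_right_comm]))
      (Polynomial.aeval Polynomial.X c)
    rw [contract_split_newtonE] at h
    have h' := Submodule.smul_of_tower_mem _ (((s + 1 : ℕ) : k))⁻¹ h
    rwa [inv_smul_smul₀ (Nat.cast_ne_zero.mpr s.succ_ne_zero)] at h'

end LowerIdeal

/-! ### Restriction to a subset of the variables -/

section Join

variable (k : Type*) [Field k] (r s : ℕ)

/-- Pairs of polynomials in separate variables, as polynomials in all variables. -/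
def joinPoly :
    MvPolynomial (Fin r) k ⊗[k] MvPolynomial (Fin s) k ≃ₐ[k] MvPolynomial (Fin (r + s)) k :=
  (MvPolynomial.tensorEquivSum k (Fin r) (Fin s) k).trans
    (MvPolynomial.renameEquiv k finSumFinEquiv)

/-- Polynomials symmetric in two separate sets of variables, as polynomials in all variables. -/
def BiSym.join : BiSym k r s →ₐ[k] MvPolynomial (Fin (r + s)) k :=
  BiSym.lift ((MvPolynomial.rename (Fin.castAdd s)).comp
      (MvPolynomial.symmetricSubalgebra (Fin r) k).val)
    ((MvPolynomial.rename (Fin.natAdd r)).comp (MvPolynomial.symmetricSubalgebra (Fin s) k).val)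

variable {k r s}

theorem joinPoly_tmul (u : MvPolynomial (Fin r) k) (v : MvPolynomial (Fin s) k) :
    joinPoly k r s (u ⊗ₜ v) = MvPolynomial.rename (Fin.castAdd s) u *
      MvPolynomial.rename (Fin.natAdd r) v := by
  have h : (joinPoly k r s).toAlgHom = Algebra.TensorProduct.productMap
      (MvPolynomial.rename (Fin.castAdd s)) (MvPolynomial.rename (Fin.natAdd r)) :=
    Algebra.TensorProduct.ext (MvPolynomial.algHom_ext fun i => by simp [joinPoly])
      (MvPolynomial.algHom_ext fun i => by simp [joinPoly])
  exact (DFunLike.congr_fun h _).trans (Algebra.TensorProduct.productMap_apply_tmul _ _ _ _)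

theorem BiSym.join_inl (y : SymPoly k r) : BiSym.join k r s (BiSym.inl y) =
    MvPolynomial.rename (Fin.castAdd s) (y : MvPolynomial (Fin r) k) := BiSym.lift_inl _ _ _

theorem BiSym.join_inr (y : SymPoly k s) : BiSym.join k r s (BiSym.inr y) =
    MvPolynomial.rename (Fin.natAdd r) (y : MvPolynomial (Fin s) k) := BiSym.lift_inr _ _ _

variable (k r s) in
theorem BiSym.join_injective : Function.Injective (BiSym.join k r s) := by
  let ι : SymPoly k r ⊗[k] SymPoly k s →ₗ[k]
      MvPolynomial (Fin r) k ⊗[k] MvPolynomial (Fin s) k :=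
    TensorProduct.map (MvPolynomial.symmetricSubalgebra (Fin r) k).val.toLinearMap
      (MvPolynomial.symmetricSubalgebra (Fin s) k).val.toLinearMap
  have hι : Function.Injective ι :=
    TensorProduct.map_injective_of_flat_flat _ _ Subtype.val_injective Subtype.val_injective
  have hjoin : (BiSym.join k r s).toLinearMap = (joinPoly k r s).toLinearMap ∘ₗ ι :=
    BiSym.linearMap_ext fun y m => by
      rw [AlgHom.toLinearMap_apply, map_mul, BiSym.join_inl, BiSym.join_inr, BiSym.inl_mul_inr]
      exact (joinPoly_tmul _ _).symm
  have h : Function.Injective (BiSym.join k r s).toLinearMap := by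
    rw [hjoin]
    exact (joinPoly k r s).injective.comp hι
  exact h

/-- A pair of permutations acts on the union of two sets of variables. -/
def joinPerm (σ : Equiv.Perm (Fin r)) (τ : Equiv.Perm (Fin s)) : Equiv.Perm (Fin (r + s)) :=
  finSumFinEquiv.permCongr (Equiv.sumCongr σ τ)

theorem joinPerm_castAdd (σ : Equiv.Perm (Fin r)) (τ : Equiv.Perm (Fin s)) (i : Fin r) :
    joinPerm σ τ (Fin.castAdd s i) = Fin.castAdd s (σ i) := by
  simp [joinPerm]

theorem joinPerm_natAdd (σ : Equiv.Perm (Fin r)) (τ : Equiv.Perm (Fin s)) (i : Fin s) :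
    joinPerm σ τ (Fin.natAdd r i) = Fin.natAdd r (τ i) := by
  simp [joinPerm]

/-- The sum over all permutations of the variables. -/
def symmetrize (u : MvPolynomial (Fin r) k) : SymPoly k r :=
  ⟨∑ σ : Equiv.Perm (Fin r), MvPolynomial.rename σ u, fun e => by
    rw [map_sum]
    refine Fintype.sum_equiv (Equiv.mulLeft e) _ _ fun σ => ?_
    rw [MvPolynomial.rename_rename]
    rfl⟩

theorem BiSym.join_symmetrize_mul_symmetrize (u : MvPolynomial (Fin r) k)
    (v : MvPolynomial (Fin s) k) :
    BiSym.join k r s (BiSym.inl (symmetrize u) * BiSym.inr (symmetrize v)) =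
      ∑ σ, ∑ τ, MvPolynomial.rename (joinPerm σ τ) (joinPoly k r s (u ⊗ₜ v)) := by
  rw [map_mul, BiSym.join_inl, BiSym.join_inr, symmetrize, symmetrize, map_sum, map_sum,
    Finset.sum_mul_sum]
  refine Finset.sum_congr rfl fun σ _ => Finset.sum_congr rfl fun τ _ => ?_
  rw [joinPoly_tmul, map_mul]
  simp only [MvPolynomial.rename_rename]
  congr 3
  · exact funext fun i => (joinPerm_castAdd σ τ i).symm
  · exact funext fun i => (joinPerm_natAdd σ τ i).symm

theorem BiSym.sum_rename_joinPerm_mem_range_join (p : MvPolynomial (Fin (r + s)) k) :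
    ∑ σ, ∑ τ, MvPolynomial.rename (joinPerm σ τ) p ∈ (BiSym.join k r s).range := by
  obtain ⟨t, rfl⟩ := (joinPoly k r s).surjective p
  induction t using TensorProduct.induction_on with
  | zero => simp
  | add x y hx hy =>
    simp only [map_add, Finset.sum_add_distrib]
    exact add_mem hx hy
  | tmul u v => exact ⟨_, BiSym.join_symmetrize_mul_symmetrize u v⟩

variable [CharZero k]

theorem BiSym.mem_range_join {p : MvPolynomial (Fin (r + s)) k}
    (hp : ∀ σ τ, MvPolynomial.rename (joinPerm σ τ) p = p) : p ∈ (BiSym.join k r s).range := by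
  have hsum := BiSym.sum_rename_joinPerm_mem_range_join p
  simp only [hp, Finset.sum_const, Finset.card_univ, Fintype.card_perm, Fintype.card_fin,
    ← Nat.cast_smul_eq_nsmul k, smul_smul] at hsum
  have hne : (r.factorial : k) * s.factorial ≠ 0 := mul_ne_zero
    (Nat.cast_ne_zero.mpr r.factorial_ne_zero) (Nat.cast_ne_zero.mpr s.factorial_ne_zero)
  simpa only [inv_smul_smul₀ hne] using
    (BiSym.join k r s).range.smul_mem hsum ((r.factorial : k) * s.factorial)⁻¹

variable (k r s)

theorem exists_comul : ∃ f : SymPoly k (r + s) →ₐ[k] BiSym k r s,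
    ∀ m, BiSym.join k r s (f m) = m := by
  obtain ⟨f, hf⟩ := SymPoly.exists_algHom (k := k) (m := r + s)
    fun j => (BiSym.inl (newton k r j) + BiSym.inr (newton k s j) : BiSym k r s)
  have h : (BiSym.join k r s).comp f = (MvPolynomial.symmetricSubalgebra (Fin (r + s)) k).val :=
    SymPoly.algHom_ext fun j h1 h2 => by
      rw [AlgHom.comp_apply, hf j h1 h2, map_add, BiSym.join_inl, BiSym.join_inr]
      simp [coe_newton, MvPolynomial.psum, Fin.sum_univ_add]
  exact ⟨f, DFunLike.congr_fun h⟩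

/-- A symmetric polynomial in `r + s` variables, as a polynomial in two sets of variables. -/
def comul : SymPoly k (r + s) →ₐ[k] BiSym k r s := (exists_comul k r s).choose

theorem join_comul (m : SymPoly k (r + s)) : BiSym.join k r s (comul k r s m) = m :=
  (exists_comul k r s).choose_spec m

theorem comul_powerSum (a : Polynomial k) : comul k r s (powerSum k (r + s) a) =
    BiSym.inl (powerSum k r a) + BiSym.inr (powerSum k s a) := by
  refine BiSym.join_injective k r s ?_
  rw [join_comul, map_add, BiSym.join_inl, BiSym.join_inr]
  simp only [coe_powerSum, map_sum, Fin.sum_univ_add, ← Polynomial.aeval_algHom_apply,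
    MvPolynomial.rename_X]

/-- The algebra homomorphism `y ⊗ m ↦ y(x₁, …, xᵣ) m(x₁, …, xᵣ₊ₛ)`. -/
def BiSym.restrict : BiSym k r (r + s) →ₐ[k] BiSym k r s := BiSym.lift BiSym.inl (comul k r s)

variable {k r s} in
theorem BiSym.restrict_inl (y : SymPoly k r) :
    BiSym.restrict k r s (BiSym.inl y) = BiSym.inl y := BiSym.lift_inl _ _ _

variable {k r s} in
theorem BiSym.restrict_inr (m : SymPoly k (r + s)) :
    BiSym.restrict k r s (BiSym.inr m) = comul k r s m := BiSym.lift_inr _ _ _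

theorem BiSym.restrict_shiftedSum (a : Polynomial k) :
    BiSym.restrict k r s (shiftedSum k (r + s) r a) = BiSym.inr (powerSum k s a) := by
  rw [shiftedSum_apply, map_sub, BiSym.restrict_inl, BiSym.restrict_inr, comul_powerSum,
    add_sub_cancel_left]

theorem BiSym.restrict_surjective : Function.Surjective (BiSym.restrict k r s) := by
  refine (AlgHom.range_eq_top _).mp (BiSym.subalgebra_eq_top_of_newton_mem (fun j => ?_)
    fun j => ?_)
  · exact ⟨_, BiSym.restrict_inl _⟩
  · rw [← powerSum_X_pow]
    exact ⟨_, BiSym.restrict_shiftedSum k r s _⟩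

theorem join_restrict_inl_mul_inr (y : SymPoly k r) (m : SymPoly k (r + s)) :
    BiSym.join k r s (BiSym.restrict k r s (BiSym.inl y * BiSym.inr m)) =
      MvPolynomial.rename (Fin.castAdd s) (y : MvPolynomial (Fin r) k) * m := by
  rw [map_mul, map_mul, BiSym.restrict_inl, BiSym.restrict_inr, BiSym.join_inl, join_comul]

end Join

section Relations

variable {k : Type*} [Field k] [CharZero k] {r s : ℕ} {W : Type*} [AddCommGroup W] [Module k W]
  [LieRingModule (Current k (Polynomial k)) W] [LieModule k (Current k (Polynomial k)) W]

/-- Modulo `lowerIdeal w r`, the elements `shiftedSum` satisfy the relations that characterise the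
power sums in `s` variables. Hence the quotient map factors through `BiSym.restrict`. -/
theorem IsHighestWeight.exists_comp_restrict_eq_mk {w : SymPoly k (r + s) →ₗ[k] W}
    (hw : IsHighestWeight (r + s) w) (h0 : lowerMap w (r + s + 1) = 0) :
    ∃ θ : BiSym k r s →ₐ[k] BiSym k r (r + s) ⧸ lowerIdeal w r,
      θ.comp (BiSym.restrict k r s) = Ideal.Quotient.mkₐ k (lowerIdeal w r) := by
  set q := Ideal.Quotient.mkₐ k (lowerIdeal w r)
  have h1 : (q.toLinearMap ∘ₗ shiftedSum k (r + s) r) 1 = s := by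
    rw [LinearMap.comp_apply, shiftedSum_apply, powerSum_one, powerSum_one]
    simp
  have hnewton (a : Polynomial k) :
      newtonE k (fun j => (q.toLinearMap ∘ₗ shiftedSum k (r + s) r) (a ^ j)) (s + 1) = 0 :=
    (map_newtonE k _ q (s + 1)).symm.trans
      (Ideal.Quotient.eq_zero_iff_mem.mpr (hw.newtonE_mem_lowerIdeal (s := s + 1) h0 a))
  obtain ⟨θ, hθ⟩ := SymPoly.exists_algHom_of_newtonE _ h1 hnewton
  refine ⟨BiSym.lift (q.comp BiSym.inl) θ, BiSym.algHom_ext_of_newton (fun j => ?_) fun j => ?_⟩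
  · rw [AlgHom.comp_apply, BiSym.restrict_inl, BiSym.lift_inl, AlgHom.comp_apply]
  · rw [AlgHom.comp_apply, BiSym.restrict_inr, ← powerSum_X_pow, comul_powerSum, map_add,
      BiSym.lift_inl, BiSym.lift_inr, hθ, AlgHom.comp_apply, LinearMap.comp_apply,
      AlgHom.toLinearMap_apply, ← map_add, shiftedSum_apply, add_sub_cancel]

theorem IsHighestWeight.lowerMap_eq_zero {w : SymPoly k (r + s) →ₗ[k] W}
    (hw : IsHighestWeight (r + s) w) (h0 : lowerMap w (r + s + 1) = 0) {x : BiSym k r (r + s)}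
    (hx : BiSym.restrict k r s x = 0) : lowerMap w r x = 0 := by
  obtain ⟨θ, hθ⟩ := hw.exists_comp_restrict_eq_mk h0
  refine lowerMap_eq_zero_of_mem (Ideal.Quotient.eq_zero_iff_mem.mp ?_)
  rw [← Ideal.Quotient.mkₐ_eq_mk k, ← hθ, AlgHom.comp_apply, hx, map_zero]

end Relations

/-! ### Modules generated by a highest weight map -/

section Generation

theorem Current.lie_mem_of_forall_lie_mem {k : Type*} [Field k] {A : Type*} [CommRing A]
    [Algebra k A] {W : Type*} [AddCommGroup W] [Module k W] [LieRingModule (Current k A) W]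
    [LieModule k (Current k A) W] {S : Submodule k W} (he : ∀ a, ∀ v ∈ S, ⁅eElt k (a : A), v⁆ ∈ S)
    (hh : ∀ a, ∀ v ∈ S, ⁅hElt k (a : A), v⁆ ∈ S) (hf : ∀ a, ∀ v ∈ S, ⁅fElt k (a : A), v⁆ ∈ S)
    (g : Current k A) {v : W} (hv : v ∈ S) : ⁅g, v⁆ ∈ S := by
  let N : Submodule k (Current k A) :=
    { carrier := {g | ∀ v ∈ S, ⁅g, v⁆ ∈ S}
      zero_mem' := fun v _ => by rw [zero_lie]; exact zero_mem S
      add_mem' := fun hx hy v hv => by rw [add_lie]; exact add_mem (hx v hv) (hy v hv)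
      smul_mem' := fun c x hx v hv => by rw [smul_lie]; exact S.smul_mem c (hx v hv) }
  exact Submodule.eq_top_iff'.mp (Current.submodule_eq_top (N := N) he hh hf) g v hv

variable {k : Type*} [Field k] {n r : ℕ}
  {W : Type*} [AddCommGroup W] [Module k W] [LieRingModule (Current k (Polynomial k)) W]
  [LieModule k (Current k (Polynomial k)) W] {w : SymPoly k n →ₗ[k] W}

theorem map_lowerOp_pow_smul {W' : Type*} [AddCommGroup W'] [Module k W']
    [LieRingModule (Current k (Polynomial k)) W'] [LieModule k (Current k (Polynomial k)) W']
    (ψ : W →ₗ⁅k,Current k (Polynomial k)⁆ W') (a : Polynomial k) (r : ℕ) (x : W) :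
    ψ (lowerOp k W a ^ r • x) = lowerOp k W' a ^ r • ψ x := by
  induction r with
  | zero => rw [pow_zero, pow_zero, one_smul, one_smul]
  | succ r ih =>
    rw [pow_succ', pow_succ', mul_smul, mul_smul, lowerOp_smul, lowerOp_smul, ψ.map_lie, ih]

variable [CharZero k]

theorem lowerMap_mem_of_powerProd {E : Type*} [AddCommGroup E] [Module k E] {T : W →ₗ[k] E}
    {S : Submodule k E} (h : ∀ a m, T (lowerOp k W a ^ r • w m) ∈ S) (x : BiSym k r n) :
    T (lowerMap w r x) ∈ S := by
  have hq : (S.mkQ ∘ₗ T) ∘ₗ lowerMap w r = 0 := BiSym.linearMap_ext_powerProd fun a m => by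
    rw [LinearMap.comp_apply, lowerMap_powerProd]
    exact (Submodule.Quotient.mk_eq_zero S).mpr (h a m)
  exact (Submodule.Quotient.mk_eq_zero S).mp (LinearMap.congr_fun hq x)

theorem map_lowerMap {W' : Type*} [AddCommGroup W'] [Module k W']
    [LieRingModule (Current k (Polynomial k)) W'] [LieModule k (Current k (Polynomial k)) W']
    {ψ : W →ₗ⁅k,Current k (Polynomial k)⁆ W'} {w' : SymPoly k n →ₗ[k] W'}
    (h : ∀ m, ψ (w m) = w' m) (x : BiSym k r n) : ψ (lowerMap w r x) = lowerMap w' r x := by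
  have hψ : (ψ : W →ₗ[k] W') ∘ₗ lowerMap w r = lowerMap w' r :=
    BiSym.linearMap_ext_powerProd fun a m => by
      rw [LinearMap.comp_apply, lowerMap_powerProd, lowerMap_powerProd, ← h]
      exact map_lowerOp_pow_smul ψ a r (w m)
  exact LinearMap.congr_fun hψ x

theorem lowerMap_eq_zero_of_le {s : ℕ} (hrs : r ≤ s) (h : lowerMap w r = 0) :
    lowerMap w s = 0 := by
  refine BiSym.linearMap_ext_powerProd fun a m => ?_
  rw [lowerMap_powerProd, ← Nat.sub_add_cancel hrs, pow_add, mul_smul, ← lowerMap_powerProd, h]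
  exact smul_zero _

/-- The product is extracted, by interpolation, as the coefficient of `s` in the powers
`f(s b + a) ^ (r + 1)`. -/
theorem lowerOp_mul_pow_smul_mem_range_lowerMap (a b : Polynomial k) (r : ℕ) (m : SymPoly k n) :
    (lowerOp k W b * lowerOp k W a ^ r) • w m ∈ LinearMap.range (lowerMap w (r + 1)) := by
  have hsum (s : k) : ∑ i ∈ Finset.range (r + 2), s ^ i • (r + 1).choose i •
      (lowerOp k W b ^ i * lowerOp k W a ^ (r + 1 - i)) • w m ∈
        LinearMap.range (lowerMap w (r + 1)) := by
    refine ⟨BiSym.inl (powerProd k (r + 1) (s • b + a)) * BiSym.inr m, ?_⟩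
    rw [lowerMap_powerProd, map_add, map_smul, add_pow, Finset.sum_smul]
    refine Finset.sum_congr rfl fun i _ => ?_
    rw [smul_pow, smul_mul_assoc, smul_mul_assoc, smul_assoc, mul_comm _ (Nat.cast _), mul_smul,
      Nat.cast_smul_eq_nsmul]
  have h := mem_of_forall_sum_pow_smul_mem hsum (i := 1) (by omega)
  rw [Nat.choose_one_right, pow_one, Nat.add_sub_cancel, ← Nat.cast_smul_eq_nsmul k] at h
  exact (Submodule.smul_mem_iff _ (Nat.cast_ne_zero.mpr r.succ_ne_zero)).mp h

theorem lie_fElt_lowerMap_mem (b : Polynomial k) (x : BiSym k r n) :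
    ⁅fElt k b, lowerMap w r x⁆ ∈ LinearMap.range (lowerMap w (r + 1)) := by
  refine lowerMap_mem_of_powerProd (T := fOp k W b) (fun a m => ?_) x
  have h := lowerOp_mul_pow_smul_mem_range_lowerMap (w := w) a b r m
  rwa [mul_smul] at h

theorem IsHighestWeight.lie_hElt_lowerMap_mem (hw : IsHighestWeight n w) (b : Polynomial k)
    (x : BiSym k r n) : ⁅hElt k b, lowerMap w r x⁆ ∈ LinearMap.range (lowerMap w r) := by
  refine lowerMap_mem_of_powerProd
    (T := LieModule.toEnd k (Current k (Polynomial k)) W (hElt k b)) (fun a m => ?_) x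
  rw [LieModule.toEnd_apply_apply, lie_hElt_lowerOp_pow_smul, hw.lie_h, ← smul_assoc r,
    ← polyProd_powerProd_mul_powerSum, ← lowerMap_inl_mul_inr, ← lowerMap_powerProd]
  exact sub_mem (LinearMap.mem_range_self _ _) (nsmul_mem (LinearMap.mem_range_self _ _) _)

theorem IsHighestWeight.lie_hElt_one_lowerMap (hw : IsHighestWeight n w) (x : BiSym k r n) :
    ⁅hElt k (1 : Polynomial k), lowerMap w r x⁆ = ((n : k) - 2 * r) • lowerMap w r x := by
  have h : LieModule.toEnd k (Current k (Polynomial k)) W (hElt k 1) ∘ₗ lowerMap w r =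
      ((n : k) - 2 * r) • lowerMap w r := BiSym.linearMap_ext_powerProd fun a m => by
    have hpow : r • (lowerOp k W a * lowerOp k W a ^ (r - 1)) • w m =
        r • lowerOp k W a ^ r • w m := by
      cases r with
      | zero => simp
      | succ r => rw [Nat.add_sub_cancel, ← pow_succ']
    rw [LinearMap.comp_apply, LieModule.toEnd_apply_apply, LinearMap.smul_apply, lowerMap_powerProd,
      lie_hElt_lowerOp_pow_smul, hw.lie_h, powerSum_one, one_mul, hpow, ← nsmul_eq_mul, map_nsmul,
      smul_comm]
    generalize lowerOp k W a ^ r • w m = v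
    module
  exact LinearMap.congr_fun h x

theorem IsHighestWeight.lie_eElt_lowerMap_mem_iSup (hw : IsHighestWeight n w) (b : Polynomial k)
    (x : BiSym k r n) : ⁅eElt k b, lowerMap w r x⁆ ∈ ⨆ r, LinearMap.range (lowerMap w r) := by
  cases r with
  | zero =>
    refine lowerMap_mem_of_powerProd
      (T := LieModule.toEnd k (Current k (Polynomial k)) W (eElt k b)) (fun a m => ?_) x
    rw [pow_zero, one_smul, LieModule.toEnd_apply_apply, hw.lie_e]
    exact zero_mem _
  | succ r =>
    rw [hw.lie_eElt_lowerMap]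
    exact nsmul_mem (Submodule.mem_iSup_of_mem r (LinearMap.mem_range_self _ _)) _

theorem IsHighestWeight.lie_mem_iSup_range_lowerMap (hw : IsHighestWeight n w)
    (g : Current k (Polynomial k)) {v : W} (hv : v ∈ ⨆ r, LinearMap.range (lowerMap w r)) :
    ⁅g, v⁆ ∈ ⨆ r, LinearMap.range (lowerMap w r) := by
  have hcomap {g : Current k (Polynomial k)}
      (hg : ∀ r (x : BiSym k r n), ⁅g, lowerMap w r x⁆ ∈ ⨆ r, LinearMap.range (lowerMap w r)) :
      (⨆ r, LinearMap.range (lowerMap w r)) ≤ (⨆ r, LinearMap.range (lowerMap w r)).comap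
        (LieModule.toEnd k (Current k (Polynomial k)) W g) :=
    iSup_le fun r => LinearMap.range_le_iff_comap.mpr (eq_top_iff.mpr fun x _ => hg r x)
  exact Current.lie_mem_of_forall_lie_mem
    (fun a => hcomap fun r x => hw.lie_eElt_lowerMap_mem_iSup a x)
    (fun a => hcomap fun r x => Submodule.mem_iSup_of_mem r (hw.lie_hElt_lowerMap_mem a x))
    (fun a => hcomap fun r x => Submodule.mem_iSup_of_mem (r + 1) (lie_fElt_lowerMap_mem a x)) g hv

theorem IsHighestWeight.exists_sum_lowerMap (hw : IsHighestWeight n w)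
    (h0 : lowerMap w (n + 1) = 0)
    (hgen : ∀ N : LieSubmodule k (Current k (Polynomial k)) W, (∀ m, w m ∈ N) → N = ⊤) (v : W) :
    ∃ x : ∀ r, BiSym k r n, v = ∑ r ∈ Finset.range (n + 1), lowerMap w r (x r) := by
  let N : LieSubmodule k (Current k (Polynomial k)) W :=
    { (⨆ r, LinearMap.range (lowerMap w r) : Submodule k W) with
      lie_mem := fun h => hw.lie_mem_iSup_range_lowerMap _ h }
  have hN : N = ⊤ := hgen N fun m => Submodule.mem_iSup_of_mem 0
    ⟨BiSym.inl (powerProd k 0 1) * BiSym.inr m, by rw [lowerMap_powerProd, pow_zero, one_smul]⟩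
  have hv : v ∈ ⨆ r, LinearMap.range (lowerMap w r) := (hN ▸ LieSubmodule.mem_top v : v ∈ N)
  have hle : (⨆ r, LinearMap.range (lowerMap w r)) ≤
      ⨆ r ∈ Finset.range (n + 1), LinearMap.range (lowerMap w r) := iSup_le fun r => by
    by_cases hr : r < n + 1
    · exact le_biSup (fun r => LinearMap.range (lowerMap w r)) (Finset.mem_range.mpr hr)
    · rw [lowerMap_eq_zero_of_le (not_lt.mp hr) h0, LinearMap.range_zero]
      exact bot_le
  obtain ⟨u, hu⟩ := (Submodule.mem_iSup_finset_iff_exists_sum _ v).mp (hle hv)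
  choose x hx using fun r => (u r).2
  exact ⟨x, by simp only [hx, hu]⟩

end Generation

/-! ### Verma modules and Weyl modules -/

section VermaModule

attribute [local instance 100] LieRing.ofAssociativeRing

theorem envelopingSubalgebra_eq_top_of_ι_mem {R L : Type*} [CommRing R] [LieRing L]
    [LieAlgebra R L] {S : Subalgebra R (UniversalEnvelopingAlgebra R L)}
    (h : ∀ x, UniversalEnvelopingAlgebra.ι R x ∈ S) : S = ⊤ := by
  let f : L →ₗ⁅R⁆ S :=
    { (UniversalEnvelopingAlgebra.ι R : L →ₗ⁅R⁆ _).toLinearMap.codRestrict S.toSubmodule h with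
      map_lie' := fun {x y} => Subtype.ext ((UniversalEnvelopingAlgebra.ι R).map_lie x y) }
  have hf : S.val.comp (UniversalEnvelopingAlgebra.lift R f) = AlgHom.id R _ := by
    apply UniversalEnvelopingAlgebra.hom_ext R
    ext x
    change S.val (UniversalEnvelopingAlgebra.lift R f (UniversalEnvelopingAlgebra.ι R x)) = _
    rw [UniversalEnvelopingAlgebra.lift_ι_apply]
    rfl
  refine Algebra.eq_top_iff.mpr fun u => ?_
  rw [← AlgHom.id_apply (R := R) u, ← hf]
  exact (UniversalEnvelopingAlgebra.lift R f u).2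

variable {k : Type*} [Field k] {A : Type*} [CommRing A] [Algebra k A]
  {M : Type*} [AddCommGroup M] [Module k M] (ρ : A →ₗ[k] Module.End k M)

/-- The canonical map `m ↦ 1 ⊗ m` from `M` to the Verma module `V(M)`. -/
def Verma.of : M →ₗ[k] Verma ρ where
  toFun m := Submodule.Quotient.mk (1 ⊗ₜ[k] m)
  map_add' m m' := by rw [TensorProduct.tmul_add]; rfl
  map_smul' c m := by rw [TensorProduct.tmul_smul]; rfl

theorem Verma.lie_of (x : Current k A) (m : M) : ⁅x, Verma.of ρ m⁆ =
    (vermaRel ρ).mkQ ((1 * UniversalEnvelopingAlgebra.ι k x) ⊗ₜ[k] m) := by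
  change (vermaRel ρ).mkQ (UniversalEnvelopingAlgebra.ι k x • (1 ⊗ₜ[k] m)) = _
  rw [TensorProduct.smul_tmul', smul_eq_mul, mul_one, one_mul]

theorem Verma.lie_eElt_of (a : A) (m : M) : ⁅eElt k a, Verma.of ρ m⁆ = 0 := by
  rw [Verma.lie_of]
  exact (Submodule.Quotient.mk_eq_zero _).mpr (Submodule.subset_span (.inl ⟨1, a, m, rfl⟩))

theorem Verma.lie_hElt_of (a : A) (m : M) : ⁅hElt k a, Verma.of ρ m⁆ = Verma.of ρ (ρ a m) := by
  rw [Verma.lie_of]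
  exact (Submodule.Quotient.eq _).mpr (Submodule.subset_span (.inr ⟨1, a, m, rfl⟩))

variable {ρ}

theorem Verma.eq_top_of_of_mem {N : LieSubmodule k (Current k A) (Verma ρ)}
    (h : ∀ m, Verma.of ρ m ∈ N) : N = ⊤ := by
  let S : Subalgebra k (UniversalEnvelopingAlgebra k (Current k A)) :=
    { carrier := {u | ∀ v ∈ N, u • v ∈ N}
      mul_mem' := fun hx hy v hv => by rw [mul_smul]; exact hx _ (hy v hv)
      add_mem' := fun hx hy v hv => by rw [add_smul]; exact add_mem (hx v hv) (hy v hv)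
      algebraMap_mem' := fun c v hv => by rw [algebraMap_smul]; exact N.smul_mem c hv }
  have hS : S = ⊤ := envelopingSubalgebra_eq_top_of_ι_mem fun x v hv => N.lie_mem hv
  refine eq_top_iff.mpr fun v _ => ?_
  obtain ⟨z, rfl⟩ := Submodule.Quotient.mk_surjective (vermaRel ρ) v
  induction z using TensorProduct.induction_on with
  | zero => exact zero_mem N
  | add x y hx hy => exact add_mem (hx trivial) (hy trivial)
  | tmul u m =>
    have hu : u ⊗ₜ[k] m = u • ((1 : UniversalEnvelopingAlgebra k (Current k A)) ⊗ₜ[k] m) := by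
      rw [TensorProduct.smul_tmul', smul_eq_mul, mul_one]
    rw [hu]
    exact (hS ▸ Algebra.mem_top : u ∈ S) _ (h m)

variable {W : Type*} [AddCommGroup W] [Module k W] [LieRingModule (Current k A) W]
  [LieModule k (Current k A) W]

/-- The map `u ⊗ m ↦ u w(m)` from `U(sl₂(A)) ⊗ M` to an `sl₂(A)`-module `W` induced by a linear
map `w : M → W`. -/
def envelopingAct (w : M →ₗ[k] W) : UniversalEnvelopingAlgebra k (Current k A) ⊗[k] M →ₗ[k] W :=
  TensorProduct.lift (LinearMap.lcomp k W w ∘ₗ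
    (UniversalEnvelopingAlgebra.lift k (LieModule.toEnd k (Current k A) W)).toLinearMap)

theorem envelopingAct_tmul (w : M →ₗ[k] W) (u : UniversalEnvelopingAlgebra k (Current k A))
    (m : M) : envelopingAct w (u ⊗ₜ m) =
      UniversalEnvelopingAlgebra.lift k (LieModule.toEnd k (Current k A) W) u (w m) := rfl

theorem envelopingAct_smul (w : M →ₗ[k] W) (u : UniversalEnvelopingAlgebra k (Current k A))
    (z : UniversalEnvelopingAlgebra k (Current k A) ⊗[k] M) : envelopingAct w (u • z) =
      UniversalEnvelopingAlgebra.lift k (LieModule.toEnd k (Current k A) W) u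
        (envelopingAct w z) := by
  induction z using TensorProduct.induction_on with
  | zero => rw [smul_zero, map_zero, map_zero]
  | add x y hx hy => rw [smul_add, map_add, hx, hy, map_add, map_add]
  | tmul u' m =>
    rw [TensorProduct.smul_tmul', envelopingAct_tmul, envelopingAct_tmul, smul_eq_mul, map_mul,
      Module.End.mul_apply]

theorem envelopingAct_mul_ι_tmul (w : M →ₗ[k] W)
    (u : UniversalEnvelopingAlgebra k (Current k A)) (x : Current k A) (m : M) :
    envelopingAct w ((u * UniversalEnvelopingAlgebra.ι k x) ⊗ₜ m) =
      UniversalEnvelopingAlgebra.lift k (LieModule.toEnd k (Current k A) W) u ⁅x, w m⁆ := by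
  rw [envelopingAct_tmul, map_mul, Module.End.mul_apply, UniversalEnvelopingAlgebra.lift_ι_apply,
    LieModule.toEnd_apply_apply]

theorem envelopingAct_eq_zero_of_mem_vermaRel {w : M →ₗ[k] W}
    (he : ∀ (a : A) m, ⁅eElt k a, w m⁆ = 0) (hh : ∀ (a : A) m, ⁅hElt k a, w m⁆ = w (ρ a m))
    {z : UniversalEnvelopingAlgebra k (Current k A) ⊗[k] M} (hz : z ∈ vermaRel ρ) :
    envelopingAct w z = 0 := by
  induction hz using Submodule.span_induction with
  | mem z hz =>
    obtain ⟨u, a, m, rfl⟩ | ⟨u, a, m, rfl⟩ := hz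
    · rw [envelopingAct_mul_ι_tmul, he, map_zero]
    · rw [map_sub, envelopingAct_mul_ι_tmul, hh, envelopingAct_tmul, sub_self]
  | zero => rw [map_zero]
  | add x y _ _ hx hy => rw [map_add, hx, hy, add_zero]
  | smul u z _ hz => rw [envelopingAct_smul, hz, map_zero]

theorem Verma.exists_lift {w : M →ₗ[k] W} (he : ∀ (a : A) m, ⁅eElt k a, w m⁆ = 0)
    (hh : ∀ (a : A) m, ⁅hElt k a, w m⁆ = w (ρ a m)) :
    ∃ ψ : Verma ρ →ₗ⁅k,Current k A⁆ W, ∀ m, ψ (Verma.of ρ m) = w m := by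
  let g : Verma ρ →ₗ[k] W :=
    ((vermaRel ρ).restrictScalars k).liftQ (envelopingAct w)
      (fun z hz => envelopingAct_eq_zero_of_mem_vermaRel he hh hz) ∘ₗ
        (Submodule.Quotient.restrictScalarsEquiv k (vermaRel ρ)).symm.toLinearMap
  have hg (z) : g ((vermaRel ρ).mkQ z) = envelopingAct w z := rfl
  refine ⟨{ g with map_lie' := fun {x v} => ?_ }, fun m => ?_⟩
  · obtain ⟨z, rfl⟩ := Submodule.mkQ_surjective (vermaRel ρ) v
    change g ((vermaRel ρ).mkQ (UniversalEnvelopingAlgebra.ι k x • z)) = ⁅x, g _⁆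
    rw [hg, hg, envelopingAct_smul, UniversalEnvelopingAlgebra.lift_ι_apply,
      LieModule.toEnd_apply_apply]
  · change envelopingAct w (1 ⊗ₜ m) = w m
    rw [envelopingAct_tmul, map_one, Module.End.one_apply]

end VermaModule

section WeylModule

theorem exists_lieModuleHom_quotient {R L V W : Type*} [CommRing R] [LieRing L] [LieAlgebra R L]
    [AddCommGroup V] [Module R V] [LieRingModule L V] [LieModule R L V]
    [AddCommGroup W] [Module R W] [LieRingModule L W]
    {N : LieSubmodule R L V} {ψ : V →ₗ⁅R,L⁆ W} (h : N ≤ ψ.ker) :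
    ∃ φ : V ⧸ N →ₗ⁅R,L⁆ W, ∀ v, φ (LieSubmodule.Quotient.mk' N v) = ψ v := by
  let f : V ⧸ N →ₗ[R] W := N.toSubmodule.liftQ (ψ : V →ₗ[R] W) fun v hv => h hv
  have hf (v) : f (LieSubmodule.Quotient.mk' N v) = ψ v := rfl
  refine ⟨{ f with map_lie' := fun {x v} => ?_ }, hf⟩
  obtain ⟨v, rfl⟩ := LieSubmodule.Quotient.surjective_mk' N v
  change f ⁅x, LieSubmodule.Quotient.mk' N v⁆ = ⁅x, f (LieSubmodule.Quotient.mk' N v)⁆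
  rw [← LieModuleHom.map_lie, hf, hf, LieModuleHom.map_lie]

variable {k : Type*} [Field k] {A : Type*} [CommRing A] [Algebra k A]
  {M : Type*} [AddCommGroup M] [Module k M] (n : ℕ) (ρ : A →ₗ[k] Module.End k M)

/-- The canonical map from `M` to the Weyl module `Δ_n(M)`. -/
def weylOf : M →ₗ[k] WeylModule n ρ :=
  (LieSubmodule.Quotient.mk' (lowSubmodule n ρ) : _ →ₗ[k] _) ∘ₗ Verma.of ρ

theorem weylOf_apply (m : M) :
    weylOf n ρ m = LieSubmodule.Quotient.mk' (lowSubmodule n ρ) (Verma.of ρ m) := rfl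

variable {n ρ}

theorem WeylModule.eq_top_of_weylOf_mem {N : LieSubmodule k (Current k A) (WeylModule n ρ)}
    (h : ∀ m, weylOf n ρ m ∈ N) : N = ⊤ := by
  have hN : N.comap (LieSubmodule.Quotient.mk' (lowSubmodule n ρ)) = ⊤ := Verma.eq_top_of_of_mem h
  refine eq_top_iff.mpr fun v _ => ?_
  obtain ⟨z, rfl⟩ := LieSubmodule.Quotient.surjective_mk' _ v
  exact (hN ▸ LieSubmodule.mem_top z : z ∈ N.comap _)

theorem mk'_eq_zero_of_mem_weightSpace {ℓ : ℤ} (hℓ : ℓ < -n) {v : Verma ρ}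
    (hv : v ∈ weightSpace (k := k) (A := A) (Verma ρ) ℓ) :
    LieSubmodule.Quotient.mk' (lowSubmodule n ρ) v = 0 :=
  (LieSubmodule.Quotient.mk_eq_zero _).mpr
    (LieSubmodule.subset_lieSpan (Submodule.mem_iSup_of_mem ℓ (Submodule.mem_iSup_of_mem hℓ hv)))

theorem WeylModule.exists_lift {W : Type*} [AddCommGroup W] [Module k W]
    [LieRingModule (Current k A) W] [LieModule k (Current k A) W] {w : M →ₗ[k] W}
    (he : ∀ (a : A) m, ⁅eElt k a, w m⁆ = 0) (hh : ∀ (a : A) m, ⁅hElt k a, w m⁆ = w (ρ a m))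
    (hlow : ∀ ℓ : ℤ, ℓ < -n → weightSpace (k := k) (A := A) W ℓ = ⊥) :
    ∃ φ : WeylModule n ρ →ₗ⁅k,Current k A⁆ W, ∀ m, φ (weylOf n ρ m) = w m := by
  obtain ⟨ψ, hψ⟩ := Verma.exists_lift he hh
  have hle : (⨆ ℓ : ℤ, ⨆ _ : ℓ < -(n : ℤ), weightSpace (k := k) (A := A) (Verma ρ) ℓ) ≤
      ψ.ker.toSubmodule := iSup₂_le fun ℓ hℓ v hv => by
    have hψv : ψ v ∈ weightSpace (k := k) (A := A) W ℓ := by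
      rw [weightSpace, Module.End.mem_eigenspace_iff, LieModule.toEnd_apply_apply] at hv ⊢
      rw [← LieModuleHom.map_lie, hv, map_smul]
    rw [hlow ℓ hℓ] at hψv
    exact ψ.mem_ker.mpr hψv
  obtain ⟨φ, hφ⟩ := exists_lieModuleHom_quotient (N := lowSubmodule n ρ)
    (LieSubmodule.lieSpan_le.mpr hle)
  exact ⟨φ, fun m => (hφ _).trans (hψ m)⟩

end WeylModule

section WeylNewton

variable {k : Type*} [Field k] (n : ℕ)

theorem isHighestWeight_vermaOf : IsHighestWeight n (Verma.of (newtonAction k n)) where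
  lie_e := Verma.lie_eElt_of _
  lie_h a m := by rw [Verma.lie_hElt_of, newtonAction_apply]

theorem isHighestWeight_weylOf : IsHighestWeight n (weylOf n (newtonAction k n)) where
  lie_e a m := by
    rw [weylOf_apply, ← LieModuleHom.map_lie, (isHighestWeight_vermaOf n).lie_e, map_zero]
  lie_h a m := by
    rw [weylOf_apply, ← LieModuleHom.map_lie, (isHighestWeight_vermaOf n).lie_h, weylOf_apply]

variable [CharZero k]

/-- The image of `lowerMap` consists of vectors of weight `n - 2(n + 1) < -n`. -/
theorem lowerMap_weylOf : lowerMap (weylOf n (newtonAction k n)) (n + 1) = 0 := by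
  refine LinearMap.ext fun x => ?_
  rw [← map_lowerMap (ψ := LieSubmodule.Quotient.mk' (lowSubmodule n (newtonAction k n)))
    fun m => (weylOf_apply n _ m).symm]
  refine mk'_eq_zero_of_mem_weightSpace (ℓ := -n - 2) (by omega) ?_
  refine Module.End.mem_eigenspace_iff.mpr ?_
  rw [LieModule.toEnd_apply_apply, (isHighestWeight_vermaOf n).lie_hElt_one_lowerMap]
  congr 1
  push_cast
  ring

theorem exists_sum_lowerMap_weylOf (v : WeylModule n (newtonAction k n)) :
    ∃ x : ∀ r, BiSym k r n, v =
      ∑ r ∈ Finset.range (n + 1), lowerMap (weylOf n (newtonAction k n)) r (x r) :=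
  (isHighestWeight_weylOf n).exists_sum_lowerMap (lowerMap_weylOf n)
    (fun _ => WeylModule.eq_top_of_weylOf_mem) v

end WeylNewton

/-! ### Symmetric tensors of the loop module -/

section Components

variable {k : Type*} [Field k]

-- Makes instance search prefer the bracket of the Lie module `L[t]` over the bare tensor bracket.
scoped instance : Bracket (Current k (Polynomial k)) (Loops k) := LieRingModule.toBracket

/-- The coordinates in `k[t]` of an element of `L[t]` with respect to the standard basis of `L`. -/
def loopCoord (k : Type*) [Field k] (j : Fin 2) : Loops k →ₗ[k] Polynomial k :=
  (TensorProduct.rid k (Polynomial k)).toLinearMap ∘ₗ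
    LinearMap.lTensor (Polynomial k) (LinearMap.proj j)

theorem loopCoord_tmul (j : Fin 2) (b : Polynomial k) (v : Fin 2 → k) :
    loopCoord k j (b ⊗ₜ v) = v j • b := by
  simp [loopCoord]

theorem loopCoord_lie_tmul (j : Fin 2) (a : Polynomial k)
    (x : LieAlgebra.SpecialLinear.sl (Fin 2) k) (u : Loops k) :
    loopCoord k j ⁅(a ⊗ₜ x : Current k (Polynomial k)), u⁆ =
      x.1 j 0 • (a * loopCoord k 0 u) + x.1 j 1 • (a * loopCoord k 1 u) := by
  induction u using TensorProduct.induction_on with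
  | zero => simp only [lie_zero, map_zero, mul_zero, smul_zero, add_zero]
  | add u v hu hv =>
    rw [lie_add, map_add, hu, hv, map_add, map_add, mul_add, mul_add, smul_add, smul_add]
    abel
  | tmul b v =>
    have hv : ⁅x, v⁆ j = x.1 j 0 * v 0 + x.1 j 1 * v 1 := by
      change Matrix.mulVec x.1 v j = _
      rw [Matrix.mulVec, dotProduct, Fin.sum_univ_two]
    refine (congrArg (loopCoord k j)
      (LieAlgebra.ExtendScalars.bracket_tmul _ _ _ _ _ _ _ _)).trans ?_
    rw [loopCoord_tmul, loopCoord_tmul, loopCoord_tmul, hv,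
      mul_smul_comm, mul_smul_comm, smul_smul, smul_smul, add_smul]

theorem loopCoord_lie_eElt (j : Fin 2) (a : Polynomial k) (u : Loops k) :
    loopCoord k j ⁅eElt k a, u⁆ = (![a, 0] : Fin 2 → Polynomial k) j * loopCoord k 1 u := by
  rw [eElt, loopCoord_lie_tmul]
  fin_cases j <;> simp

theorem loopCoord_lie_hElt (j : Fin 2) (a : Polynomial k) (u : Loops k) :
    loopCoord k j ⁅hElt k a, u⁆ = (![a, -a] : Fin 2 → Polynomial k) j * loopCoord k j u := by
  rw [hElt, loopCoord_lie_tmul]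
  fin_cases j <;> simp

theorem loopCoord_lie_fElt (j : Fin 2) (a : Polynomial k) (u : Loops k) :
    loopCoord k j ⁅fElt k a, u⁆ = (![0, a] : Fin 2 → Polynomial k) j * loopCoord k 0 u := by
  rw [fElt, loopCoord_lie_tmul]
  fin_cases j <;> simp

variable {n : ℕ}

/-- The component at `v_{ε 1} ⊗ ⋯ ⊗ v_{ε n}` of an element of `L[t]^{⊗n} = L^{⊗n} ⊗ k[t]^{⊗n}`,
where `v₀, v₁` is the standard basis of `L` and `k[t]^{⊗n}` is identified with `k[x₁, …, xₙ]`. -/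
def component (ε : Fin n → Fin 2) : (⨂[k]^n (Loops k)) →ₗ[k] MvPolynomial (Fin n) k :=
  PiTensorProduct.lift
    ((MultilinearMap.mkPiAlgebra k (Fin n) (MvPolynomial (Fin n) k)).compLinearMap fun i =>
      (Polynomial.aeval (MvPolynomial.X i)).toLinearMap ∘ₗ loopCoord k (ε i))

theorem component_tprod (ε : Fin n → Fin 2) (v : Fin n → Loops k) :
    component ε (PiTensorProduct.tprod k v) =
      ∏ i, Polynomial.aeval (MvPolynomial.X i) (loopCoord k (ε i) (v i)) := by
  rw [component, PiTensorProduct.lift.tprod]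
  rfl

/-- The basis tensor of `L[t]^{⊗n}` with factors `t ^ α i ⊗ v_{δ i}`. -/
def loopTensor (δ : Fin n → Fin 2) (α : Fin n →₀ ℕ) : ⨂[k]^n (Loops k) :=
  PiTensorProduct.tprod k fun i =>
    ((Polynomial.X ^ α i : Polynomial k) ⊗ₜ[k] (Pi.single (δ i) (1 : k) : Fin 2 → k) : Loops k)

theorem component_loopTensor (ε δ : Fin n → Fin 2) (α : Fin n →₀ ℕ) :
    component ε (loopTensor (k := k) δ α) = if ε = δ then MvPolynomial.monomial α 1 else 0 := by
  rw [loopTensor, component_tprod]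
  split_ifs with h
  · subst h
    rw [MvPolynomial.monomial_eq, map_one, one_mul, Finsupp.prod_fintype _ _ fun i => pow_zero _]
    refine Finset.prod_congr rfl fun i _ => ?_
    rw [loopCoord_tmul, Pi.single_eq_same, one_smul, map_pow, Polynomial.aeval_X]
  · obtain ⟨i, hi⟩ := Function.ne_iff.mp h
    refine Finset.prod_eq_zero (Finset.mem_univ i) ?_
    rw [loopCoord_tmul, Pi.single_eq_of_ne hi, zero_smul, map_zero]

/-- The basis of `L[t]^{⊗n}` formed by the tensors `loopTensor`. -/
def loopTensorBasis (k : Type*) [Field k] (n : ℕ) :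
    Module.Basis (Fin n → ℕ × Fin 2) k (⨂[k]^n (Loops k)) :=
  Basis.piTensorProduct fun _ =>
    (Polynomial.basisMonomials k).tensorProduct (Pi.basisFun k (Fin 2))

theorem loopTensorBasis_apply (p : Fin n → ℕ × Fin 2) : loopTensorBasis k n p =
    loopTensor (fun i => (p i).2) (Finsupp.equivFunOnFinite.symm fun i => (p i).1) := by
  rw [loopTensorBasis, Basis.piTensorProduct_apply, loopTensor]
  congr 1
  funext i
  refine (Module.Basis.tensorProduct_apply _ _ _ _).trans ?_
  rw [Pi.basisFun_apply, Polynomial.coe_basisMonomials, Finsupp.equivFunOnFinite_symm_apply_apply,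
    Polynomial.X_pow_eq_monomial]

theorem coeff_component_eq_coord (q : Fin n → ℕ × Fin 2) :
    MvPolynomial.lcoeff k (Finsupp.equivFunOnFinite.symm fun i => (q i).1) ∘ₗ
      component (fun i => (q i).2) = (loopTensorBasis k n).coord q := by
  refine (loopTensorBasis k n).ext fun p => ?_
  rw [LinearMap.comp_apply, Module.Basis.coord_apply, Module.Basis.repr_self,
    loopTensorBasis_apply, component_loopTensor, MvPolynomial.lcoeff_apply]
  by_cases hqp : q = p
  · rw [hqp, if_pos rfl, MvPolynomial.coeff_monomial, if_pos rfl, Finsupp.single_eq_same]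
  · rw [Finsupp.single_eq_of_ne hqp]
    split_ifs with hε
    · rw [MvPolynomial.coeff_monomial, if_neg fun hα => hqp (funext fun i => ?_)]
      exact Prod.ext (congrFun (Finsupp.equivFunOnFinite.symm.injective hα) i).symm (congrFun hε i)
    · exact MvPolynomial.coeff_zero _

theorem eq_of_component_eq {z z' : ⨂[k]^n (Loops k)} (h : ∀ ε, component ε z = component ε z') :
    z = z' := by
  refine (loopTensorBasis k n).ext_elem fun q => ?_
  rw [← Module.Basis.coord_apply, ← Module.Basis.coord_apply, ← coeff_component_eq_coord,
    LinearMap.comp_apply, LinearMap.comp_apply, h]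

theorem component_reindex (ε : Fin n → Fin 2) (σ : Equiv.Perm (Fin n)) (z : ⨂[k]^n (Loops k)) :
    component ε (PiTensorProduct.reindex k (fun _ => Loops k) σ z) =
      MvPolynomial.rename σ (component (ε ∘ σ) z) := by
  have h : component ε ∘ₗ (PiTensorProduct.reindex k (fun _ => Loops k) σ).toLinearMap =
      (MvPolynomial.rename σ).toLinearMap ∘ₗ component (ε ∘ σ) := by
    refine PiTensorProduct.ext (MultilinearMap.ext fun v => ?_)
    simp only [LinearMap.compMultilinearMap_apply, LinearMap.comp_apply, LinearEquiv.coe_coe,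
      PiTensorProduct.reindex_tprod, component_tprod, AlgHom.toLinearMap_apply, map_prod]
    refine (Fintype.prod_equiv σ _ _ fun i => ?_).symm
    rw [← Polynomial.aeval_algHom_apply, MvPolynomial.rename_X, Equiv.symm_apply_apply,
      Function.comp_apply]
  exact LinearMap.congr_fun h z

/-- The elements `e(a)`, `h(a)`, `f(a)` act on `L[t]` by matrices with one entry in each row;
the entry in row `j` is `c j`, in column `τ j`. -/
theorem component_lie {g : Current k (Polynomial k)} {c : Fin 2 → Polynomial k}
    {τ : Fin 2 → Fin 2} (hg : ∀ j u, loopCoord k j ⁅g, u⁆ = c j * loopCoord k (τ j) u)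
    (ε : Fin n → Fin 2) (z : ⨂[k]^n (Loops k)) :
    component ε ⁅g, z⁆ = ∑ i, Polynomial.aeval (MvPolynomial.X i) (c (ε i)) *
      component (Function.update ε i (τ (ε i))) z := by
  have h : component ε ∘ₗ tensorAction (k := k) (Loops k) n g =
      ∑ i, LinearMap.mulLeft k (Polynomial.aeval (MvPolynomial.X i) (c (ε i))) ∘ₗ
        component (Function.update ε i (τ (ε i))) := by
    refine PiTensorProduct.ext (MultilinearMap.ext fun v => ?_)
    simp only [LinearMap.compMultilinearMap_apply, LinearMap.comp_apply, tensorAction_tprod,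
      map_sum, LinearMap.sum_apply, LinearMap.mulLeft_apply, component_tprod]
    refine Finset.sum_congr rfl fun i _ => ?_
    rw [← Finset.mul_prod_erase _ _ (Finset.mem_univ i),
      ← Finset.mul_prod_erase _ (fun j => Polynomial.aeval _ (loopCoord k _ (v j)))
        (Finset.mem_univ i), Function.update_self, Function.update_self, hg, map_mul, mul_assoc]
    congr 2
    refine Finset.prod_congr rfl fun j hj => ?_
    rw [Function.update_of_ne (Finset.ne_of_mem_erase hj),
      Function.update_of_ne (Finset.ne_of_mem_erase hj)]
  refine (LinearMap.congr_fun h z).trans ?_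
  simp only [LinearMap.sum_apply, LinearMap.comp_apply, LinearMap.mulLeft_apply]

theorem component_lie_eElt_of_forall_ne {ε : Fin n → Fin 2} {z : ⨂[k]^n (Loops k)}
    (h : ∀ i, component (Function.update ε i 1) z = 0) (a : Polynomial k) :
    component ε ⁅eElt k a, z⁆ = 0 := by
  rw [component_lie (τ := fun _ => 1) fun j u => loopCoord_lie_eElt j a u]
  exact Finset.sum_eq_zero fun i _ => by rw [h, mul_zero]

theorem component_lie_hElt (a : Polynomial k) (ε : Fin n → Fin 2) (z : ⨂[k]^n (Loops k)) :
    component ε ⁅hElt k a, z⁆ = (∑ i, Polynomial.aeval (MvPolynomial.X i : MvPolynomial (Fin n) k)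
      ((![a, -a] : Fin 2 → Polynomial k) (ε i))) * component ε z := by
  rw [component_lie (τ := id) fun j u => loopCoord_lie_hElt j a u, Finset.sum_mul]
  simp only [id, Function.update_eq_self]

/-- The positions of the factors at which `ε` selects the lower basis vector `v₁` of `L`. -/
def ones (ε : Fin n → Fin 2) : Finset (Fin n) := Finset.univ.filter fun i => ε i = 1

theorem mem_ones {ε : Fin n → Fin 2} {i : Fin n} : i ∈ ones ε ↔ ε i = 1 := by
  rw [ones, Finset.mem_filter, and_iff_right (Finset.mem_univ i)]

theorem card_ones_eq_zero {ε : Fin n → Fin 2} : (ones ε).card = 0 ↔ ε = 0 := by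
  rw [Finset.card_eq_zero, Finset.eq_empty_iff_forall_notMem, funext_iff]
  refine forall_congr' fun i => ?_
  rw [mem_ones, Pi.zero_apply]
  omega

theorem ones_update_zero (ε : Fin n → Fin 2) (i : Fin n) :
    ones (Function.update ε i 0) = (ones ε).erase i := by
  ext j
  rw [Finset.mem_erase, mem_ones, mem_ones]
  by_cases hj : j = i
  · rw [hj, Function.update_self]
    simp
  · rw [Function.update_of_ne hj, and_iff_right hj]

theorem component_lie_fElt (a : Polynomial k) (ε : Fin n → Fin 2) (z : ⨂[k]^n (Loops k)) :
    component ε ⁅fElt k a, z⁆ = ∑ i ∈ ones ε,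
      Polynomial.aeval (MvPolynomial.X i) a * component (Function.update ε i 0) z := by
  rw [component_lie (τ := fun _ => 0) fun j u => loopCoord_lie_fElt j a u, ones,
    Finset.sum_filter]
  refine Finset.sum_congr rfl fun i _ => ?_
  obtain h | h : ε i = 0 ∨ ε i = 1 := by omega
  · rw [h, if_neg zero_ne_one, Matrix.cons_val_zero, map_zero, zero_mul]
  · rw [h, if_pos rfl, Matrix.cons_val_one, Matrix.cons_val_zero]

theorem component_lie_hElt_one (ε : Fin n → Fin 2) (z : ⨂[k]^n (Loops k)) :
    component ε ⁅hElt k (1 : Polynomial k), z⁆ =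
      ((n - 2 * (ones ε).card : ℤ) : k) • component ε z := by
  have hsign (i : Fin n) : Polynomial.aeval (MvPolynomial.X i : MvPolynomial (Fin n) k)
      ((![1, -1] : Fin 2 → Polynomial k) (ε i)) =
        (1 - 2 * if ε i = 1 then 1 else 0 : MvPolynomial (Fin n) k) := by
    obtain h | h : ε i = 0 ∨ ε i = 1 := by omega
    · simp [h]
    · simp only [h, Matrix.cons_val_one, Matrix.cons_val_fin_one, Polynomial.aeval_neg, map_one,
        if_true, mul_one]
      norm_num
  rw [component_lie_hElt, Finset.sum_congr rfl fun i _ => hsign i, Finset.sum_sub_distrib,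
    ← Finset.mul_sum, Finset.sum_boole, MvPolynomial.smul_eq_C_mul, map_intCast]
  simp [ones]

end Components

section SymLoops

/-- The `sl₂[t]`-module `S^n(L[t])`. -/
abbrev SymLoops (k : Type*) [Field k] (n : ℕ) :
    LieSubmodule k (Current k (Polynomial k)) (⨂[k]^n (Loops k)) :=
  symTensors (k := k) (G := Current k (Polynomial k)) (Loops k) n

variable {k : Type*} [Field k] {n : ℕ}

-- Shortcuts: the search for these instances otherwise times out.
scoped instance : AddCommGroup (SymLoops k n) := AddSubgroupClass.toAddCommGroup (SymLoops k n)

scoped instance : AddCommMonoid (SymLoops k n) :=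
  (AddSubgroupClass.toAddCommGroup (SymLoops k n)).toAddCommMonoid

scoped instance : Zero (SymLoops k n) :=
  (AddSubgroupClass.toAddCommGroup (SymLoops k n)).toAddCommMonoid.toZero

scoped instance : Module k (SymLoops k n) := SubmoduleClass.module (SymLoops k n)

theorem SymLoops.component_eq_rename (z : SymLoops k n) (ε : Fin n → Fin 2)
    (σ : Equiv.Perm (Fin n)) :
    component ε z.1 = MvPolynomial.rename σ (component (ε ∘ σ) z.1) := by
  rw [← component_reindex, z.2 σ]

theorem SymLoops.ext {z z' : SymLoops k n} (h : ∀ ε, component ε z.1 = component ε z'.1) :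
    z = z' :=
  Subtype.ext (eq_of_component_eq h)

theorem weightSpace_symLoops_eq_bot [CharZero k] {ℓ : ℤ} (hℓ : ℓ < -n) :
    weightSpace (k := k) (A := Polynomial k) (SymLoops k n) ℓ = ⊥ := by
  refine eq_bot_iff.mpr fun z hz => SymLoops.ext fun ε => ?_
  rw [weightSpace, Module.End.mem_eigenspace_iff, LieModule.toEnd_apply_apply] at hz
  have hcomp : ((n - 2 * (ones ε).card : ℤ) : k) • component ε z.1 = (ℓ : k) • component ε z.1 := by
    rw [← component_lie_hElt_one, ← LieSubmodule.coe_bracket, hz, ← map_smul]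
    rfl
  rw [← sub_eq_zero, ← sub_smul, ← Int.cast_sub] at hcomp
  refine ((smul_eq_zero.mp hcomp).resolve_left (Int.cast_ne_zero.mpr ?_)).trans (map_zero _).symm
  have hcard : (ones ε).card ≤ n := (Finset.card_le_univ _).trans_eq (Fintype.card_fin n)
  omega

/-- The embedding of `k[x₁, …, xₙ] = k[t]^{⊗n}` into `L[t]^{⊗n}` onto the tensors all of whose
factors are multiples of the highest weight vector `v₀` of `L`. -/
def highTensor (k : Type*) [Field k] (n : ℕ) : MvPolynomial (Fin n) k →ₗ[k] ⨂[k]^n (Loops k) :=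
  (MvPolynomial.basisMonomials (Fin n) k).constr k (loopTensor 0)

theorem component_highTensor (ε : Fin n → Fin 2) (m : MvPolynomial (Fin n) k) :
    component ε (highTensor k n m) = if ε = 0 then m else 0 := by
  have h : component ε ∘ₗ highTensor k n = if ε = 0 then LinearMap.id else 0 := by
    refine (MvPolynomial.basisMonomials (Fin n) k).ext fun α => ?_
    rw [LinearMap.comp_apply, highTensor, Module.Basis.constr_basis, component_loopTensor]
    split_ifs <;> simp
  rw [← LinearMap.comp_apply, h]
  split_ifs <;> rfl

theorem highTensor_mem (m : SymPoly k n) : highTensor k n m ∈ SymLoops k n := fun σ => by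
  have hε (ε : Fin n → Fin 2) : ε ∘ σ = 0 ↔ ε = 0 :=
    ⟨fun h => σ.surjective.injective_comp_right h, fun h => by rw [h]; rfl⟩
  refine eq_of_component_eq fun ε => ?_
  rw [component_reindex, component_highTensor, component_highTensor, if_congr (hε ε) rfl rfl,
    apply_ite (MvPolynomial.rename σ), map_zero, m.2 σ]

/-- The restriction `k[x₁, …, xₙ]^{Sₙ} → S^n(L[t])` of `highTensor`. -/
def symHigh (k : Type*) [Field k] (n : ℕ) : SymPoly k n →ₗ[k] SymLoops k n :=
  (highTensor k n ∘ₗ (MvPolynomial.symmetricSubalgebra (Fin n) k).val.toLinearMap).codRestrict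
    (SymLoops k n).toSubmodule highTensor_mem

theorem coe_symHigh (m : SymPoly k n) :
    (symHigh k n m : ⨂[k]^n (Loops k)) = highTensor k n m := rfl

theorem component_symHigh (ε : Fin n → Fin 2) (m : SymPoly k n) :
    component ε (symHigh k n m : ⨂[k]^n (Loops k)) =
      if ε = 0 then (m : MvPolynomial (Fin n) k) else 0 := by
  rw [coe_symHigh, component_highTensor]

theorem isHighestWeight_symHigh : IsHighestWeight n (symHigh k n) where
  lie_e a m := SymLoops.ext fun ε => by
    rw [LieSubmodule.coe_bracket, component_lie_eElt_of_forall_ne fun i => ?_]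
    · exact (map_zero _).symm
    · rw [component_symHigh, if_neg fun h => ?_]
      exact one_ne_zero ((Function.update_self i 1 ε).symm.trans (congrFun h i))
  lie_h a m := SymLoops.ext fun ε => by
    rw [LieSubmodule.coe_bracket, component_lie_hElt, component_symHigh, component_symHigh]
    split_ifs with h
    · rw [h, MulMemClass.coe_mul, coe_powerSum]
      rfl
    · exact mul_zero _

end SymLoops

/-! ### The Weyl module of the symmetric polynomials -/

section InitialComponent

variable {k : Type*} [Field k] {n : ℕ}

theorem component_lowerOp_pow_smul (a : Polynomial k) (r : ℕ) (m : SymPoly k n)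
    (ε : Fin n → Fin 2) :
    component ε (lowerOp k (SymLoops k n) a ^ r • symHigh k n m).1 =
      if (ones ε).card = r then r.factorial •
        ((∏ i ∈ ones ε, Polynomial.aeval (MvPolynomial.X i) a) * (m : MvPolynomial (Fin n) k))
      else 0 := by
  induction r generalizing ε with
  | zero =>
    rw [pow_zero, one_smul, component_symHigh, if_congr card_ones_eq_zero rfl rfl]
    split_ifs with h
    · rw [Finset.card_eq_zero.mp (card_ones_eq_zero.mpr h), Finset.prod_empty, one_mul,
        Nat.factorial_zero, one_smul]
    · rfl
  | succ r ih =>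
    rw [pow_succ', mul_smul, lowerOp_smul, LieSubmodule.coe_bracket, component_lie_fElt]
    have hterm (i : Fin n) (hi : i ∈ ones ε) :
        Polynomial.aeval (MvPolynomial.X i : MvPolynomial (Fin n) k) a *
          component (Function.update ε i 0)
            (lowerOp k (SymLoops k n) a ^ r • symHigh k n m).1 =
        if (ones ε).card = r + 1 then r.factorial •
          ((∏ i ∈ ones ε, Polynomial.aeval (MvPolynomial.X i) a) * (m : MvPolynomial (Fin n) k))
        else 0 := by
      have hcard : (ones ε).card - 1 = r ↔ (ones ε).card = r + 1 := by
        have := Finset.card_pos.mpr ⟨i, hi⟩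
        omega
      rw [ih, ones_update_zero, Finset.card_erase_of_mem hi, if_congr hcard rfl rfl, mul_ite,
        mul_zero, ← Finset.mul_prod_erase _ _ hi, mul_smul_comm, mul_assoc]
    rw [Finset.sum_congr rfl hterm, Finset.sum_const]
    split_ifs with h
    · rw [h, smul_smul, Nat.factorial_succ]
    · exact smul_zero _

/-- The sequence `1, …, 1, 0, …, 0` of length `n` with `r` ones. -/
def initialOnes (n r : ℕ) : Fin n → Fin 2 := fun i => if (i : ℕ) < r then 1 else 0

theorem initialOnes_castAdd {r s : ℕ} (i : Fin r) : initialOnes (r + s) r (Fin.castAdd s i) = 1 :=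
  if_pos i.2

theorem initialOnes_natAdd {r s : ℕ} (i : Fin s) : initialOnes (r + s) r (Fin.natAdd r i) = 0 :=
  if_neg (by simp)

theorem initialOnes_comp_joinPerm {r s : ℕ} (σ : Equiv.Perm (Fin r)) (τ : Equiv.Perm (Fin s)) :
    initialOnes (r + s) r ∘ joinPerm σ τ = initialOnes (r + s) r := by
  funext i
  rw [Function.comp_apply]
  induction i using Fin.addCases with
  | left i => rw [joinPerm_castAdd, initialOnes_castAdd, initialOnes_castAdd]
  | right i => rw [joinPerm_natAdd, initialOnes_natAdd, initialOnes_natAdd]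

theorem prod_ones_initialOnes {B : Type*} [CommMonoid B] (r s : ℕ) (f : Fin (r + s) → B) :
    ∏ i ∈ ones (initialOnes (r + s) r), f i = ∏ i : Fin r, f (Fin.castAdd s i) := by
  rw [ones, Finset.prod_filter, Fin.prod_univ_add]
  simp only [initialOnes_castAdd, initialOnes_natAdd, if_true, zero_ne_one, if_false,
    Finset.prod_const_one, mul_one]

theorem card_ones_initialOnes {r : ℕ} (hr : r ≤ n) : (ones (initialOnes n r)).card = r := by
  obtain ⟨s, rfl⟩ := Nat.exists_eq_add_of_le hr
  rw [ones, Finset.card_filter, Fin.sum_univ_add]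
  simp only [initialOnes_castAdd, initialOnes_natAdd, if_true, zero_ne_one, if_false,
    Finset.sum_const_zero, add_zero, Finset.sum_const, Finset.card_univ, Fintype.card_fin,
    smul_eq_mul, mul_one]

theorem exists_comp_eq_initialOnes (ε : Fin n → Fin 2) :
    ∃ r ≤ n, ∃ σ : Equiv.Perm (Fin n), ε ∘ σ = initialOnes n r := by
  have hle : (ones ε).card ≤ n := (Finset.card_le_univ _).trans_eq (Fintype.card_fin n)
  let e : {i // i ∈ ones (initialOnes n (ones ε).card)} ≃ {i // i ∈ ones ε} :=
    Finset.equivOfCardEq (card_ones_initialOnes hle)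
  refine ⟨(ones ε).card, hle, e.extendSubtype, funext fun i => ?_⟩
  have hiff : ε (e.extendSubtype i) = 1 ↔ initialOnes n (ones ε).card i = 1 := by
    rw [← mem_ones, ← mem_ones]
    exact ⟨not_imp_not.mp (e.extendSubtype_not_mem i), e.extendSubtype_mem i⟩
  rw [Function.comp_apply]
  omega

/-- The component of a symmetric tensor with `v₁` in the first `r` factors and `v₀` in the other
ones. By symmetry a tensor is determined by these components. -/
def initialComponent (k : Type*) [Field k] (n r : ℕ) :
    SymLoops k n →ₗ[k] MvPolynomial (Fin n) k :=
  component (initialOnes n r) ∘ₗ (SymLoops k n).toSubmodule.subtype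

theorem SymLoops.ext_initialComponent {z z' : SymLoops k n}
    (h : ∀ r ≤ n, initialComponent k n r z = initialComponent k n r z') : z = z' :=
  SymLoops.ext fun ε => by
    obtain ⟨r, hr, σ, hσ⟩ := exists_comp_eq_initialOnes ε
    rw [SymLoops.component_eq_rename z ε σ, SymLoops.component_eq_rename z' ε σ, hσ]
    exact congrArg _ (h r hr)

theorem initialComponent_lowerOp_pow_smul {r : ℕ} (hr : r ≤ n) (a : Polynomial k) (j : ℕ)
    (m : SymPoly k n) :
    initialComponent k n r (lowerOp k (SymLoops k n) a ^ j • symHigh k n m) =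
      if r = j then j.factorial • ((∏ i ∈ ones (initialOnes n r),
        Polynomial.aeval (MvPolynomial.X i) a) * (m : MvPolynomial (Fin n) k)) else 0 := by
  rw [initialComponent, LinearMap.comp_apply]
  refine (component_lowerOp_pow_smul a j m _).trans ?_
  rw [card_ones_initialOnes hr]

variable [CharZero k]

theorem initialComponent_lowerMap (r s : ℕ) (x : BiSym k r (r + s)) :
    initialComponent k (r + s) r (lowerMap (symHigh k (r + s)) r x) =
      r.factorial • BiSym.join k r s (BiSym.restrict k r s x) := by
  have h : initialComponent k (r + s) r ∘ₗ lowerMap (symHigh k (r + s)) r =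
      r.factorial • ((BiSym.join k r s).comp (BiSym.restrict k r s)).toLinearMap :=
    BiSym.linearMap_ext_powerProd fun a m => by
      rw [LinearMap.smul_apply, AlgHom.toLinearMap_apply, AlgHom.comp_apply,
        join_restrict_inl_mul_inr, LinearMap.comp_apply, lowerMap_powerProd,
        initialComponent_lowerOp_pow_smul (Nat.le_add_right r s), if_pos rfl,
        prod_ones_initialOnes, coe_powerProd, map_prod]
      simp only [← Polynomial.aeval_algHom_apply, MvPolynomial.rename_X]
  exact LinearMap.congr_fun h x

theorem initialComponent_lowerMap_of_ne {r j : ℕ} (hr : r ≤ n) (hj : j ≠ r) (x : BiSym k j n) :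
    initialComponent k n r (lowerMap (symHigh k n) j x) = 0 := by
  have h : initialComponent k n r ∘ₗ lowerMap (symHigh k n) j = 0 :=
    BiSym.linearMap_ext_powerProd fun a m => by
      rw [LinearMap.comp_apply, lowerMap_powerProd, initialComponent_lowerOp_pow_smul hr,
        if_neg hj.symm, LinearMap.zero_apply]
  exact LinearMap.congr_fun h x

theorem initialComponent_sum_lowerMap {r : ℕ} (hr : r ≤ n) (x : ∀ j, BiSym k j n) :
    initialComponent k n r (∑ j ∈ Finset.range (n + 1), lowerMap (symHigh k n) j (x j)) =
      initialComponent k n r (lowerMap (symHigh k n) r (x r)) := by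
  rw [map_sum]
  exact Finset.sum_eq_single_of_mem r (Finset.mem_range.mpr (Nat.lt_succ_of_le hr))
    fun j _ hj => initialComponent_lowerMap_of_ne hr hj _

theorem restrict_eq_zero_of_initialComponent_eq_zero {r s : ℕ} {x : BiSym k r (r + s)}
    (h : initialComponent k (r + s) r (lowerMap (symHigh k (r + s)) r x) = 0) :
    BiSym.restrict k r s x = 0 := by
  rw [initialComponent_lowerMap, ← Nat.cast_smul_eq_nsmul k] at h
  have hjoin := (smul_eq_zero.mp h).resolve_left (Nat.cast_ne_zero.mpr r.factorial_ne_zero)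
  exact BiSym.join_injective k r s (hjoin.trans (map_zero _).symm)

theorem exists_initialComponent_lowerMap_eq {r : ℕ} (hr : r ≤ n) (z : SymLoops k n) :
    ∃ x : BiSym k r n, initialComponent k n r (lowerMap (symHigh k n) r x) =
      initialComponent k n r z := by
  obtain ⟨s, rfl⟩ := Nat.exists_eq_add_of_le hr
  obtain ⟨y, hy⟩ := BiSym.mem_range_join (p := initialComponent k (r + s) r z) fun σ τ => by
    have h := SymLoops.component_eq_rename z (initialOnes (r + s) r) (joinPerm σ τ)
    rw [initialOnes_comp_joinPerm] at h
    exact h.symm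
  obtain ⟨x, rfl⟩ := BiSym.restrict_surjective k r s y
  refine ⟨(r.factorial : k)⁻¹ • x, ?_⟩
  rw [initialComponent_lowerMap, map_smul, map_smul, ← Nat.cast_smul_eq_nsmul k, smul_smul,
    mul_inv_cancel₀ (Nat.cast_ne_zero.mpr r.factorial_ne_zero), one_smul]
  exact hy

end InitialComponent

section Comparison

variable {k : Type*} [Field k] [CharZero k] {n : ℕ}

variable (k n) in
theorem exists_weylModule_hom : ∃ φ : WeylModule n (newtonAction k n)
    →ₗ⁅k,Current k (Polynomial k)⁆ SymLoops k n,
      ∀ m, φ (weylOf n (newtonAction k n) m) = symHigh k n m :=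
  WeylModule.exists_lift isHighestWeight_symHigh.lie_e
    (fun a m => by rw [isHighestWeight_symHigh.lie_h, newtonAction_apply])
    fun _ => weightSpace_symLoops_eq_bot

theorem lowerMap_weylOf_eq_zero {r : ℕ} (hr : r ≤ n) {x : BiSym k r n}
    (hx : initialComponent k n r (lowerMap (symHigh k n) r x) = 0) :
    lowerMap (weylOf n (newtonAction k n)) r x = 0 := by
  obtain ⟨s, rfl⟩ := Nat.exists_eq_add_of_le hr
  exact (isHighestWeight_weylOf (r + s)).lowerMap_eq_zero (lowerMap_weylOf (r + s))
    (restrict_eq_zero_of_initialComponent_eq_zero hx)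

variable {φ : WeylModule n (newtonAction k n) →ₗ⁅k,Current k (Polynomial k)⁆ SymLoops k n}

theorem weylModule_hom_sum (hφ : ∀ m, φ (weylOf n (newtonAction k n) m) = symHigh k n m)
    (x : ∀ r, BiSym k r n) :
    φ (∑ r ∈ Finset.range (n + 1), lowerMap (weylOf n (newtonAction k n)) r (x r)) =
      ∑ r ∈ Finset.range (n + 1), lowerMap (symHigh k n) r (x r) := by
  rw [map_sum]
  exact Finset.sum_congr rfl fun r _ => map_lowerMap hφ (x r)

theorem weylModule_hom_injective
    (hφ : ∀ m, φ (weylOf n (newtonAction k n) m) = symHigh k n m) : Function.Injective φ := by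
  refine (injective_iff_map_eq_zero φ).mpr fun v hv => ?_
  obtain ⟨x, rfl⟩ := exists_sum_lowerMap_weylOf n v
  rw [weylModule_hom_sum hφ] at hv
  refine Finset.sum_eq_zero fun r hr => ?_
  have hr : r ≤ n := Nat.lt_succ_iff.mp (Finset.mem_range.mp hr)
  exact lowerMap_weylOf_eq_zero hr (by rw [← initialComponent_sum_lowerMap hr, hv, map_zero])

theorem weylModule_hom_surjective
    (hφ : ∀ m, φ (weylOf n (newtonAction k n) m) = symHigh k n m) : Function.Surjective φ := by
  intro z
  choose x hx using fun (r : ℕ) (hr : r ≤ n) => exists_initialComponent_lowerMap_eq hr z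
  let y (r : ℕ) : BiSym k r n := if hr : r ≤ n then x r hr else 0
  refine ⟨∑ r ∈ Finset.range (n + 1), lowerMap (weylOf n (newtonAction k n)) r (y r), ?_⟩
  refine (weylModule_hom_sum hφ y).trans (SymLoops.ext_initialComponent fun r hr => ?_)
  rw [initialComponent_sum_lowerMap hr, ← hx r hr, show y r = x r hr from dif_pos hr]

variable (k n) in
theorem nonempty_weylModule_equiv : Nonempty (WeylModule n (newtonAction k n)
    ≃ₗ⁅k,Current k (Polynomial k)⁆ SymLoops k n) := by
  obtain ⟨φ, hφ⟩ := exists_weylModule_hom k n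
  let e := Equiv.ofBijective φ ⟨weylModule_hom_injective hφ, weylModule_hom_surjective hφ⟩
  exact ⟨{ φ with invFun := e.symm, left_inv := e.left_inv, right_inv := e.right_inv }⟩

end Comparison

end JordanWeyl

end

theorem mainTheorem4_general (k : Type*) [Field k] [CharZero k] (n : ℕ) :
    JordanWeyl.IsFreeOfRank n 1 (JordanWeyl.newtonAction k n) ∧
      Nonempty
        (JordanWeyl.WeylModule n (JordanWeyl.newtonAction k n)
          ≃ₗ⁅k, JordanWeyl.Current k (Polynomial k)⁆
        JordanWeyl.symTensors (k := k) (G := JordanWeyl.Current k (Polynomial k))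
          (JordanWeyl.Loops k) n) :=
  ⟨JordanWeyl.isFreeOfRank_newtonAction n, JordanWeyl.nonempty_weylModule_equiv k n⟩

theorem mainTheorem4 (k : Type*) [Field k] [IsAlgClosed k] [CharZero k] (n : ℕ) :
    JordanWeyl.IsFreeOfRank n 1 (JordanWeyl.newtonAction k n) ∧
      Nonempty
        (JordanWeyl.WeylModule n (JordanWeyl.newtonAction k n)
          ≃ₗ⁅k, JordanWeyl.Current k (Polynomial k)⁆
        JordanWeyl.symTensors (k := k) (G := JordanWeyl.Current k (Polynomial k))
          (JordanWeyl.Loops k) n) := by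
  exact mainTheorem4_general k n
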